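/- Let $\underline k\le\bar k$ and $\underline u\le\bar u$ be real numbers. Let $k:\mathbb R\to[\underline k,\bar k]$ (a.e.) be in $L^\infty(\mathbb R)$ with finite total variation $\|k\|_{BV}$. Let $f=f(k,u)$ be defined on $[\underline k,\bar k]\times[\underline u,\bar u]$ such that: (i) for each $k$, $f(k,\cdot)\in C^3[\underline u,\bar u]$ is strictly convex, and $0<\gamma_1\le f_{uu}(k,u)\le\gamma_2$ for all $(k,u)$; (ii) for each $u$, $f(\cdot,u)\in C^2[\underline k,\bar k]$ with $f_{kk}\equiv 0$, and $f_u(\cdot,u)\in C^1[\underline k,\bar k]$; (iii) $f(k_1,\bar u)=f(k_2,\bar u)$ and $f(k_1,\underline u)=f(k_2,\underline u)$ for all $k_1,k_2\in[\underline k,\bar k]$. Write $\|f_u\|,\|f_k\|,\|f_{uk}\|,\|f_{ku}\|$ for the sup norms of these partial derivatives over $[\underline k,\bar k]\times[\underline u,\bar u]$ (where $f_{uk}=\partial_k f_u$ and $f_{ku}=\partial_u f_k$), $\|k\|$ for the $L^\infty$ norm of $k$, $C_{u_0}:=\max\{|\underline u|,|\bar u|\}$ and $a_+:=\max\{a,0\}$.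 Let $\Delta x,\Delta t>0$, $\lambda=\Delta t/\Delta x$, and consider a uniform grid with cell centres $x_j=x_0+j\Delta x$, $x_{j\pm1/2}=x_j\pm\frac12\Delta x$ ($j\in\mathbb Z$). Put $k_j=\frac1{\Delta x}\int_{x_{j-1/2}}^{x_{j+1/2}}k(x)\,dx$. Let $(u_j^n)_{j\in\mathbb Z}$ satisfy $u^n_j\in[\underline u,\bar u]$ for all $j$ (so $|u^n_j|\le C_{u_0}$), and let $(u^{n+1}_{j+1/2})_{j\in\mathbb Z}$ be obtained from it by one step of the second-order central scheme $$u^{n+1}_{j+\frac12}=\tfrac12(u^n_j+u^n_{j+1})-\tfrac18(\sigma^n_{j+1}-\sigma^n_j)-\lambda\big(f(k_{j+1},u^{n+\frac12}_{j+1})-f(k_j,u^{n+\frac12}_j)\big),\qquad u^{n+\frac12}_j=u^n_j-\tfrac\lambda2 f_u(k_j,u^n_j)\,\sigma^n_j,$$ $$\sigma^n_j=\operatorname{minmod}\big(u^n_{j+1}-u^n_j,\ \tfrac12(u^n_{j+1}-u^n_{j-1}),\ u^n_j-u^n_{j-1}\big),$$ where $\operatorname{minmod}(a,b,c)=\operatorname{sgn}(a)\min\{|a|,|b|,|c|\}$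 if $\operatorname{sgn}a=\operatorname{sgn}b=\operatorname{sgn}c$ and $0$ otherwise. Assume the CFL condition $$\lambda\|f_u\|\le\kappa\le\min\Big\{\frac{\gamma_1}{7500\,\gamma_2},\frac1{4000}\Big\}.$$ If $\sum_{j}(u^n_j-u^n_{j-1})_+^2<\infty$ (otherwise the right-hand side below is not finite), then the other two series below converge and $$\sum_{j\in\mathbb Z}\big(u^{n+1}_{j+\frac12}-u^{n+1}_{j-\frac12}\big)_+^2\le\sum_{j\in\mathbb Z}\big(u^n_j-u^n_{j-1}\big)_+^2-\frac1{500}\lambda\gamma_1\sum_{j\in\mathbb Z}\big(u^n_j-u^n_{j-1}\big)_+^3+\Psi\,\|k\|_{BV},$$ where $$\begin{aligned}\Psi={}&72\lambda^2C_{u_0}^2\|f_{uk}\|+114\lambda C_{u_0}^2\|f_{ku}\|+\big(708C_{u_0}^2+48\lambda\|f_u\|\big)\lambda^2\|f_u\|\|f_{uk}\|\\&+\big(48\lambda^2C_{u_0}\|k\|+132\lambda^2C_{u_0}^2\gamma_2\|f_u\|+64\lambda\|f_k\|\|k\|+88C_{u_0}\big)\lambda\|f_k\|.\end{aligned}$$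 -/

import Mathlib

open Set MeasureTheory
open scoped ENNReal

noncomputable section

/-! Partial derivatives of a flux `f k u`, given on a rectangle `K ×ˢ U` of closed intervals
(one-sided derivatives at the end points), and sup norms over that rectangle. -/

/-- The partial derivative `∂g/∂u` at `(k, u)`, where `u` ranges over `U`. -/
def partialU (U : Set ℝ) (g : ℝ → ℝ → ℝ) : ℝ → ℝ → ℝ :=
  fun k u => derivWithin (fun v => g k v) U u

/-- The partial derivative `∂g/∂k` at `(k, u)`, where `k` ranges over `K`. -/
def partialK (K : Set ℝ) (g : ℝ → ℝ → ℝ) : ℝ → ℝ → ℝ :=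
  fun k u => derivWithin (fun c => g c u) K k

/-- The sup norm of `g` over the rectangle `K ×ˢ U`. -/
def rectNorm (K U : Set ℝ) (g : ℝ → ℝ → ℝ) : ℝ :=
  sSup ((fun p : ℝ × ℝ => |g p.1 p.2|) '' (K ×ˢ U))

/-- The hypotheses on the flux `f : [klo, khi] × [ulo, uhi] → ℝ`. -/
structure IsConvexFlux (klo khi ulo uhi γ₁ γ₂ : ℝ) (f : ℝ → ℝ → ℝ) : Prop where
  contDiff_u : ∀ k ∈ Icc klo khi, ContDiffOn ℝ 3 (fun u => f k u) (Icc ulo uhi)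
  strictConvex : ∀ k ∈ Icc klo khi, StrictConvexOn ℝ (Icc ulo uhi) (fun u => f k u)
  gamma_pos : 0 < γ₁
  lower : ∀ k ∈ Icc klo khi, ∀ u ∈ Icc ulo uhi,
    γ₁ ≤ partialU (Icc ulo uhi) (partialU (Icc ulo uhi) f) k u
  upper : ∀ k ∈ Icc klo khi, ∀ u ∈ Icc ulo uhi,
    partialU (Icc ulo uhi) (partialU (Icc ulo uhi) f) k u ≤ γ₂
  contDiff_k : ∀ u ∈ Icc ulo uhi, ContDiffOn ℝ 2 (fun k => f k u) (Icc klo khi)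
  kk_eq_zero : ∀ u ∈ Icc ulo uhi, ∀ k ∈ Icc klo khi,
    partialK (Icc klo khi) (partialK (Icc klo khi) f) k u = 0
  contDiff_uk : ∀ u ∈ Icc ulo uhi,
    ContDiffOn ℝ 1 (fun k => partialU (Icc ulo uhi) f k u) (Icc klo khi)
  eq_at_hi : ∀ k₁ ∈ Icc klo khi, ∀ k₂ ∈ Icc klo khi, f k₁ uhi = f k₂ uhi
  eq_at_lo : ∀ k₁ ∈ Icc klo khi, ∀ k₂ ∈ Icc klo khi, f k₁ ulo = f k₂ ulo

/-- The total variation of (the almost everywhere class of) `k` on the real line: the infimum of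
the pointwise variations of its representatives. -/
def totalVar (k : ℝ → ℝ) : ℝ≥0∞ :=
  ⨅ (g : ℝ → ℝ) (_ : g =ᵐ[volume] k), eVariationOn g univ

/-- The total variation semi-norm `‖k‖_BV` as a real number. -/
def bvNorm (k : ℝ → ℝ) : ℝ := (totalVar k).toReal

/-- The `L^∞` norm of `k` as a real number. -/
def supNorm (k : ℝ → ℝ) : ℝ := (eLpNorm k ∞ volume).toReal

/-- The hypotheses on the coefficient: `k ∈ BV ∩ L^∞` with values in `[klo, khi]` a.e. -/
structure IsCoefficient (klo khi : ℝ) (k : ℝ → ℝ) : Prop where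
  memLp : MemLp k ∞ volume
  finite_var : totalVar k ≠ ∞
  mem_Icc : ∀ᵐ x ∂(volume : Measure ℝ), k x ∈ Icc klo khi

/-- The average of `k` over the cell `[x_j - dx/2, x_j + dx/2]` with centre `x_j = x₀ + j dx`. -/
def cellAverage (dx x₀ : ℝ) (k : ℝ → ℝ) (j : ℤ) : ℝ :=
  1 / dx * ∫ x in (x₀ + (j - 1 / 2) * dx)..(x₀ + (j + 1 / 2) * dx), k x

/-- The minmod function of three arguments. -/
def minmod (a b c : ℝ) : ℝ :=
  if Real.sign a = Real.sign b ∧ Real.sign b = Real.sign c then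
    Real.sign a * min |a| (min |b| |c|)
  else 0

/-- The minmod slope `σ_j` of the sequence `u`. -/
def mmSlope (u : ℤ → ℝ) (j : ℤ) : ℝ :=
  minmod (u (j + 1) - u j) (1 / 2 * (u (j + 1) - u (j - 1))) (u j - u (j - 1))

/-- The mid-time value `u_j^{n+1/2} = u_j - (λ/2) f_u(k_j, u_j) σ_j`. -/
def midValue (lam : ℝ) (U : Set ℝ) (f : ℝ → ℝ → ℝ) (kd u : ℤ → ℝ) (j : ℤ) : ℝ :=
  u j - lam / 2 * partialU U f (kd j) (u j) * mmSlope u j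

/-- One step of the staggered second-order central scheme, applied to the cell averages `u` with
discrete coefficient `kd`: the value at index `j` is `u^{n+1}_{j+1/2}`. -/
def schemeStep (lam : ℝ) (U : Set ℝ) (f : ℝ → ℝ → ℝ) (kd u : ℤ → ℝ) (j : ℤ) : ℝ :=
  1 / 2 * (u j + u (j + 1)) - 1 / 8 * (mmSlope u (j + 1) - mmSlope u j)
    - lam * (f (kd (j + 1)) (midValue lam U f kd u (j + 1)) - f (kd j) (midValue lam U f kd u j))

/-- The constant `Ψ` as a function of `λ`, `C_{u₀}`, `γ₂` and of the norms
`‖f_u‖`, `‖f_k‖`, `‖f_{uk}‖`, `‖f_{ku}‖`, `‖k‖`. -/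
def oslConst (lam C γ₂ nfu nfk nfuk nfku nk : ℝ) : ℝ :=
  72 * lam ^ 2 * C ^ 2 * nfuk + 114 * lam * C ^ 2 * nfku
    + (708 * C ^ 2 + 48 * lam * nfu) * lam ^ 2 * nfu * nfuk
    + (48 * lam ^ 2 * C * nk + 132 * lam ^ 2 * C ^ 2 * γ₂ * nfu
        + 64 * lam * nfk * nk + 88 * C) * lam * nfk

end

/-!
The jumps of the new averages at increasing places are convex combinations of neighbouring old
jumps, corrected by the limited slopes and by the mid-time flux. Expanding the sum of their squares
and summing by parts leaves three leading terms: the dissipation `dissip`, a quadratic form in the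
second differences, which the minmod limiter keeps negative; a term of order `κ` in the second
differences, which the dissipation absorbs; and the increase of the wave speed across consecutive
positive jumps, which by uniform convexity produces the cubic gain. The remaining terms are cubic
with the factor `κ γ₂`, absorbed by the gain thanks to the bound on the Courant number, or linear in
the jumps of the coefficient, hence summable with sum at most a multiple of its total variation.
Wherever `u` does not increase, the scheme does not create a positive jump, so only the sequence of
positive parts of the jumps matters.
-/

/-! ### Telescoping inequalities -/

/-- `X ≤ Y` up to the increments of a summable sequence: the form in which a pointwise inequality
survives summation over `ℤ` (see `TelescopeLE.tsum_le`), so that summations by parts can be carried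
out before any sum is known to converge. -/
def TelescopeLE (X Y : ℤ → ℝ) : Prop :=
  ∃ H : ℤ → ℝ, Summable H ∧ ∀ j, X j ≤ Y j + (H j - H (j + 1))

theorem summable_int_shift {H : ℤ → ℝ} (hH : Summable H) (i : ℤ) :
    Summable fun j => H (j + i) :=
  (Equiv.addRight i).summable_iff.2 hH

theorem tsum_int_shift (H : ℤ → ℝ) (i : ℤ) : ∑' j, H (j + i) = ∑' j, H j :=
  (Equiv.addRight i).tsum_eq H

namespace TelescopeLE

variable {X Y X' Y' Z : ℤ → ℝ}

theorem of_le (h : ∀ j, X j ≤ Y j) : TelescopeLE X Y :=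
  ⟨fun _ => 0, summable_zero, fun j => by simpa using h j⟩

theorem add (h : TelescopeLE X Y) (h' : TelescopeLE X' Y') :
    TelescopeLE (fun j => X j + X' j) (fun j => Y j + Y' j) := by
  obtain ⟨H, hH, h⟩ := h
  obtain ⟨H', hH', h'⟩ := h'
  exact ⟨fun j => H j + H' j, hH.add hH', fun j => by linarith [h j, h' j]⟩

theorem trans (h : TelescopeLE X Y) (h' : TelescopeLE Y Z) : TelescopeLE X Z := by
  obtain ⟨H, hH, h⟩ := h
  obtain ⟨H', hH', h'⟩ := h'
  exact ⟨fun j => H j + H' j, hH.add hH', fun j => by linarith [h j, h' j]⟩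

theorem summable (h : TelescopeLE X Y) (hX : ∀ j, 0 ≤ X j) (hY : Summable Y) : Summable X := by
  obtain ⟨H, hH, h⟩ := h
  exact .of_nonneg_of_le hX h (hY.add (hH.sub (summable_int_shift hH 1)))

theorem tsum_le (h : TelescopeLE X Y) (hX : Summable X) (hY : Summable Y) :
    ∑' j, X j ≤ ∑' j, Y j := by
  obtain ⟨H, hH, h⟩ := h
  have hH' := summable_int_shift hH 1
  calc ∑' j, X j ≤ ∑' j, (Y j + (H j - H (j + 1))) := hX.tsum_le_tsum h (hY.add (hH.sub hH'))
    _ = ∑' j, Y j := by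
      rw [hY.tsum_add (hH.sub hH'), hH.tsum_sub hH', tsum_int_shift H 1, sub_self, add_zero]

end TelescopeLE

theorem telescopeLE_neighbor_sum {N : ℤ → ℝ} (hN : Summable N) :
    TelescopeLE (fun j => N (j - 1) + N j + N (j + 1)) (fun j => 3 * N j) := by
  refine ⟨fun j => N (j - 1) - N j, (summable_int_shift hN (-1)).sub hN, fun j => ?_⟩
  simp only [add_sub_cancel_right]
  linarith

/-- Square summability of a real sequence indexed by the integers. -/
def SqSummable (x : ℤ → ℝ) : Prop := Summable fun j => x j ^ 2

namespace SqSummable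

variable {x y c : ℤ → ℝ}

theorem shift (hx : SqSummable x) (i : ℤ) : SqSummable fun j => x (j + i) :=
  summable_int_shift (H := fun j => x j ^ 2) hx i

theorem mono (hx : SqSummable x) (K : ℝ) (h : ∀ j, |y j| ≤ K * |x j|) : SqSummable y := by
  refine .of_nonneg_of_le (fun j => sq_nonneg _) (fun j => ?_) (hx.mul_left (K ^ 2))
  calc y j ^ 2 = |y j| ^ 2 := (sq_abs _).symm
    _ ≤ (K * |x j|) ^ 2 := pow_le_pow_left₀ (abs_nonneg _) (h j) 2
    _ = K ^ 2 * x j ^ 2 := by rw [mul_pow, sq_abs]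

theorem bdd_mul (hx : SqSummable x) {K : ℝ} (hc : ∀ j, |c j| ≤ K) :
    SqSummable fun j => c j * x j :=
  hx.mono K fun j => by rw [abs_mul]; gcongr; exact hc j

theorem const_mul (hx : SqSummable x) (a : ℝ) : SqSummable fun j => a * x j :=
  hx.bdd_mul fun _ => le_rfl

theorem mul (hx : SqSummable x) (hy : SqSummable y) : Summable fun j => x j * y j := by
  refine .of_norm_bounded (hx.add hy) fun j => ?_
  rw [Real.norm_eq_abs, abs_le]
  constructor <;> nlinarith [sq_nonneg (x j + y j), sq_nonneg (x j - y j)]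

theorem add (hx : SqSummable x) (hy : SqSummable y) : SqSummable fun j => x j + y j :=
  ((Summable.add hx hy).add ((hx.mul hy).mul_left 2)).congr fun j => by ring

theorem sub (hx : SqSummable x) (hy : SqSummable y) : SqSummable fun j => x j - y j :=
  ((Summable.add hx hy).sub ((hx.mul hy).mul_left 2)).congr fun j => by ring

end SqSummable

/-! ### Rises and falls of a nonnegative sequence -/

theorem mul_sq_le_of_pos {d m x y W : ℝ} (hd : 0 < y → d ≤ m) (hm : 0 ≤ m) (hx : 0 ≤ x)
    (hxy : x ≤ y) (hyW : y ≤ W) : d * x ^ 2 ≤ m * W ^ 2 := by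
  rcases hx.eq_or_lt with rfl | hx
  · rw [zero_pow two_ne_zero, mul_zero]; positivity
  · have := hd (hx.trans_le hxy)
    have := hxy.trans hyW
    gcongr

theorem abs_mul_le_of_pos {x y T M : ℝ} (hx : 0 < y → |x| ≤ T) (hT : 0 ≤ T) (hy : 0 ≤ y)
    (hyM : y ≤ M) : |x * y| ≤ T * M := by
  rcases hy.eq_or_lt with rfl | hy
  · rw [mul_zero, abs_zero]; positivity
  · rw [abs_mul, abs_of_pos hy]
    have := hx hy
    gcongr

/-- The positive part of the backward difference. -/
noncomputable def rise (p : ℤ → ℝ) (j : ℤ) : ℝ := (p j - p (j - 1))⁺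

/-- The negative part of the backward difference. -/
noncomputable def fall (p : ℤ → ℝ) (j : ℤ) : ℝ := (p j - p (j - 1))⁻

/-- The contribution of the limited slopes to the flux, as a function of the positive jumps `p`:
wherever `p j > 0` it is `(σ (j + 1) - σ j) / 8` for the minmod slopes `σ` of the cells on both
sides of the jump `p j`. -/
noncomputable def recon (p : ℤ → ℝ) (j : ℤ) : ℝ := 1 / 8 * (rise p j - fall p (j + 1))

/-- The numerical dissipation, a quadratic form in the second differences of `u` when `p` is the
sequence of jumps of `u`. -/
noncomputable def dissip (p : ℤ → ℝ) (j : ℤ) : ℝ :=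
  (rise p j - rise p (j - 1)) ^ 2 + (fall p (j + 1) - fall p j) ^ 2

section Rise

variable (p : ℤ → ℝ) (j : ℤ)

theorem rise_nonneg : 0 ≤ rise p j := posPart_nonneg _

theorem fall_nonneg : 0 ≤ fall p j := negPart_nonneg _

theorem sub_le_rise : p j - p (j - 1) ≤ rise p j := le_posPart _

theorem sub_le_fall_succ : p j - p (j + 1) ≤ fall p (j + 1) := by
  simpa [fall] using neg_le_negPart (p (j + 1) - p j)

theorem rise_sub_fall : rise p j - fall p j = p j - p (j - 1) := posPart_sub_negPart _

theorem rise_mul_fall : rise p j * fall p j = 0 := by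
  unfold rise fall
  rcases le_total 0 (p j - p (j - 1)) with h | h
  · rw [negPart_eq_zero.2 h, mul_zero]
  · rw [posPart_eq_zero.2 h, zero_mul]

theorem rise_mul_fall_succ_nonneg : 0 ≤ rise p j * fall p (j + 1) :=
  mul_nonneg (rise_nonneg _ _) (fall_nonneg _ _)

theorem succ_sub_pred_eq :
    p (j + 1) - p (j - 1) = rise p j - fall p j + (rise p (j + 1) - fall p (j + 1)) := by
  rw [rise_sub_fall, rise_sub_fall, add_sub_cancel_right]; ring

theorem dissip_nonneg : 0 ≤ dissip p j := add_nonneg (sq_nonneg _) (sq_nonneg _)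

theorem sq_recon_sub_le : (recon p j - recon p (j - 1)) ^ 2 ≤ 1 / 32 * dissip p j := by
  unfold recon dissip
  rw [sub_add_cancel]
  linarith [add_sq_le (a := rise p j - rise p (j - 1)) (b := fall p j - fall p (j + 1))]

end Rise

section Nonneg

variable {p : ℤ → ℝ}

theorem rise_le (hp : ∀ j, 0 ≤ p j) (j : ℤ) : rise p j ≤ p j :=
  max_le (sub_le_self _ (hp _)) (hp j)

theorem fall_le (hp : ∀ j, 0 ≤ p j) (j : ℤ) : fall p j ≤ p (j - 1) :=
  max_le (by linarith [hp j]) (hp _)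

theorem abs_recon_le (hp : ∀ j, 0 ≤ p j) (j : ℤ) : |recon p j| ≤ 1 / 8 * p j := by
  have hfall := fall_le hp (j + 1)
  rw [add_sub_cancel_right] at hfall
  rw [recon, abs_mul, abs_of_pos (by norm_num : (0 : ℝ) < 1 / 8)]
  gcongr
  rw [abs_le]
  constructor <;> linarith [rise_le hp j, rise_nonneg p j, fall_nonneg p (j + 1)]

theorem sqSummable_rise (hs : SqSummable p) (hp : ∀ j, 0 ≤ p j) : SqSummable (rise p) :=
  hs.mono 1 fun j => by
    rw [abs_of_nonneg (rise_nonneg p j), abs_of_nonneg (hp j), one_mul]; exact rise_le hp j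

theorem sqSummable_fall (hs : SqSummable p) (hp : ∀ j, 0 ≤ p j) : SqSummable (fall p) :=
  (hs.shift (-1)).mono 1 fun j => by
    rw [abs_of_nonneg (fall_nonneg p j), abs_of_nonneg (hp _), one_mul]; exact fall_le hp j

theorem sqSummable_recon (hs : SqSummable p) (hp : ∀ j, 0 ≤ p j) : SqSummable (recon p) :=
  hs.mono (1 / 8) fun j => by rw [abs_of_nonneg (hp j)]; exact abs_recon_le hp j

end Nonneg

/-! ### Summation by parts -/

theorem telescopeLE_sq_average {p e : ℤ → ℝ} (hp : SqSummable p) (he : SqSummable e) :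
    TelescopeLE (fun j => (1 / 2 * (p (j - 1) + p j) - (e j - e (j - 1))) ^ 2)
      (fun j => p j ^ 2 - 1 / 4 * (p j - p (j - 1)) ^ 2 + e j * (p (j + 1) - p (j - 1))
        + (e j - e (j - 1)) ^ 2) := by
  have hp' := hp.shift (-1)
  refine ⟨fun j => 1 / 2 * p (j - 1) ^ 2 + (p (j - 1) + p j) * e (j - 1),
    (Summable.mul_left _ hp').add ((hp'.add hp).mul (he.shift (-1))), fun j => ?_⟩
  simp only [add_sub_cancel_right]
  apply le_of_eq
  ring

theorem minmod_dissipation_pointwise {am a ap b bp : ℝ} (ha : 0 ≤ a) (hb : 0 ≤ b)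
    (hab : a * b = 0) (habp : ap * bp = 0) :
    1 / 8 * (a - bp) * (a - b + (ap - bp)) + (1 / 8 * (a - bp) - 1 / 8 * (am - b)) ^ 2
      - 1 / 4 * (a - b) ^ 2
    ≤ -(1 / 32) * ((a - am) ^ 2 + (bp - b) ^ 2) - 1 / 4 * (a * bp)
      + ((1 / 16 * am ^ 2 - 1 / 8 * (am * a) - 3 / 16 * b ^ 2)
        - (1 / 16 * a ^ 2 - 1 / 8 * (a * ap) - 3 / 16 * bp ^ 2)) := by
  have key : am * bp ≤ a * bp + am * b + 1 / 2 * ((a - am) ^ 2 + (bp - b) ^ 2) := by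
    rcases mul_eq_zero.1 hab with rfl | rfl
    · nlinarith [sq_nonneg (am - (bp - b))]
    · nlinarith [sq_nonneg (am - a - bp), sq_nonneg (am - a + bp)]
  nlinarith [key]

theorem telescopeLE_minmod_dissipation {p : ℤ → ℝ} (hs : SqSummable p) (hp : ∀ j, 0 ≤ p j) :
    TelescopeLE
      (fun j => recon p j * (p (j + 1) - p (j - 1)) + (recon p j - recon p (j - 1)) ^ 2
        - 1 / 4 * (p j - p (j - 1)) ^ 2)
      (fun j => -(1 / 32) * dissip p j - 1 / 4 * (rise p j * fall p (j + 1))) := by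
  have hr := sqSummable_rise hs hp
  have hr' := hr.shift (-1)
  refine ⟨fun j => 1 / 16 * rise p (j - 1) ^ 2 - 1 / 8 * (rise p (j - 1) * rise p j)
    - 3 / 16 * fall p j ^ 2, ((Summable.mul_left _ hr').sub ((hr'.mul hr).mul_left _)).sub
      (Summable.mul_left _ (sqSummable_fall hs hp)), fun j => ?_⟩
  simp only [recon, dissip, add_sub_cancel_right, sub_add_cancel]
  rw [succ_sub_pred_eq, ← rise_sub_fall]
  exact minmod_dissipation_pointwise (rise_nonneg p j) (fall_nonneg p j) (rise_mul_fall p j)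
    (rise_mul_fall p (j + 1))

theorem telescopeLE_transport {p v μ : ℤ → ℝ} {g κ W : ℝ} (hs : SqSummable p)
    (hp : ∀ j, 0 ≤ p j) (hW : ∀ j, p j ≤ W) (hv : ∀ j, |v j| ≤ κ) (hμ : ∀ j, 0 ≤ μ j)
    (hmono : ∀ j, 0 < p j → 0 < p (j + 1) →
      g / 2 * (p j + p (j + 1)) - μ j ≤ v (j + 1) - v j) :
    TelescopeLE (fun j => v j * p j * (p (j + 1) - p (j - 1)))
      (fun j => -(g / 2) * (p j * p (j + 1) * (p j + p (j + 1))) + W ^ 2 * μ j) := by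
  refine ⟨fun j => -(v j * p j * p (j - 1)), ((hs.bdd_mul hv).mul (hs.shift (-1))).neg,
    fun j => ?_⟩
  simp only [add_sub_cancel_right]
  have hspeed : p j * p (j + 1) * (g / 2 * (p j + p (j + 1)) - μ j)
      ≤ p j * p (j + 1) * (v (j + 1) - v j) := by
    rcases (hp j).eq_or_lt with h | h
    · simp only [← h, zero_mul, le_refl]
    rcases (hp (j + 1)).eq_or_lt with h' | h'
    · simp only [← h', mul_zero, zero_mul, le_refl]
    exact mul_le_mul_of_nonneg_left (hmono j h h') (by positivity)
  have hcoeff : p j * p (j + 1) * μ j ≤ W ^ 2 * μ j := by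
    rw [sq]
    have := hp (j + 1)
    have := (hp j).trans (hW j)
    gcongr
    exacts [hμ j, hW j, hW (j + 1)]
  nlinarith [hspeed, hcoeff]

theorem cubic_gain_pointwise {g x y z a b : ℝ} (hg : 0 ≤ g) (hx : 0 ≤ x) (hy : 0 ≤ y)
    (hz : 0 ≤ z) (hab : 0 ≤ a * b) (hxa : y - x ≤ a) (hzb : y - z ≤ b) (hgy : g * y ≤ 1 / 6) :
    3 / 16 * g * y ^ 3 ≤
      g / 4 * (x * y * (x + y)) + g / 4 * (y * z * (y + z)) + 1 / 8 * (a * b) := by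
  have large {w : ℝ} (hw : y / 2 ≤ w) : 3 / 16 * g * y ^ 3 ≤ g / 4 * (y * w * (y + w)) := by
    have hw₀ : 0 ≤ w := by linarith
    have hyw : 3 / 2 * y ≤ y + w := by linarith
    calc 3 / 16 * g * y ^ 3 = g / 4 * (y * (y / 2) * (3 / 2 * y)) := by ring
      _ ≤ g / 4 * (y * w * (y + w)) := by gcongr
  have hxy : 0 ≤ g / 4 * (x * y * (x + y)) := by positivity
  have hyz : 0 ≤ g / 4 * (y * z * (y + z)) := by positivity
  rcases le_or_gt (y / 2) x with h | h
  · linarith [large h]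
  rcases le_or_gt (y / 2) z with h' | h'
  · linarith [large h']
  have hpeak : y / 2 * (y / 2) ≤ a * b := by gcongr <;> linarith
  have hcube : g * y * y ^ 2 ≤ 1 / 6 * y ^ 2 := by gcongr
  linarith

theorem telescopeLE_cubic_gain {p : ℤ → ℝ} {g W : ℝ} (hs : SqSummable p) (hp : ∀ j, 0 ≤ p j)
    (hW : ∀ j, p j ≤ W) (hg : 0 ≤ g) (hgp : ∀ j, g * p j ≤ 1 / 6) :
    TelescopeLE
      (fun j => -(g / 2) * (p j * p (j + 1) * (p j + p (j + 1)))
        - 1 / 8 * (rise p j * fall p (j + 1)))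
      (fun j => -(3 / 16) * g * p j ^ 3) := by
  refine ⟨fun j => g / 4 * ((p (j - 1) + p j) * p (j - 1) * p j), ?_, fun j => ?_⟩
  · have hb : ∀ j, |p (j + -1) + p j| ≤ 2 * W := fun j => by
      rw [abs_of_nonneg (add_nonneg (hp _) (hp _))]; linarith [hW (j + -1), hW j]
    exact ((((hs.shift (-1)).bdd_mul hb).mul hs).mul_left _)
  · simp only [add_sub_cancel_right]
    linarith [cubic_gain_pointwise hg (hp (j - 1)) (hp j) (hp (j + 1))
      (rise_mul_fall_succ_nonneg p j) (sub_le_rise p j) (sub_le_fall_succ p j) (hgp j)]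

theorem time_correction_pointwise {C C' κ S T am a ap b bp : ℝ} (hC : C ^ 2 ≤ κ ^ 2) (ha : 0 ≤ a)
    (hbp : 0 ≤ bp) (hab : a * b = 0) (habp : ap * bp = 0)
    (hS : (C ^ 2 - C' ^ 2) * a ^ 2 ≤ κ ^ 2 * (a - am) ^ 2 + S)
    (hT : (C ^ 2 - C' ^ 2) * b ^ 2 ≤ T) :
    C ^ 2 * (a - b) ^ 2 - 4 * C ^ 2 * (1 / 8 * (a - bp)) * (a - b + (ap - bp))
    ≤ 2 * κ ^ 2 * ((a - am) ^ 2 + (bp - b) ^ 2) + κ ^ 2 * (a * bp) + (1 / 4 * S + 3 / 4 * T)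
      + ((1 / 4 * (C' * a) ^ 2 + 3 / 4 * (C' * b) ^ 2 - 1 / 4 * (κ * (a - am)) ^ 2)
        - (1 / 4 * (C * ap) ^ 2 + 3 / 4 * (C * bp) ^ 2 - 1 / 4 * (κ * (ap - a)) ^ 2)) := by
  have hrise : C ^ 2 * (ap - a) ^ 2 ≤ κ ^ 2 * (ap - a) ^ 2 := by gcongr
  have hfall : C ^ 2 * (bp - b) ^ 2 ≤ κ ^ 2 * (bp - b) ^ 2 := by gcongr
  have hpeak : C ^ 2 * (a * bp) ≤ κ ^ 2 * (a * bp) := by gcongr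
  have hrise₀ : 0 ≤ κ ^ 2 * (a - am) ^ 2 := by positivity
  have hfall₀ : 0 ≤ κ ^ 2 * (bp - b) ^ 2 := by positivity
  linear_combination (1 / 4) * hS + (3 / 4) * hT + (1 / 4) * hrise + (1 / 4) * hfall + hpeak
    + (3 / 2) * hrise₀ + (7 / 4) * hfall₀ - (3 / 2) * C ^ 2 * hab + C ^ 2 * (1 / 2) * habp

theorem sq_sub_sq_le {x y κ τ : ℝ} (hx : |x| ≤ κ) (hy : |y| ≤ κ) (hxy : |x - y| ≤ τ) :
    x ^ 2 - y ^ 2 ≤ 2 * κ * τ :=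
  calc x ^ 2 - y ^ 2 = (x + y) * (x - y) := sq_sub_sq x y
    _ ≤ |x + y| * |x - y| := by rw [← abs_mul]; exact le_abs_self _
    _ ≤ (κ + κ) * τ := by
        have := (abs_nonneg x).trans hx
        exact mul_le_mul ((abs_add_le x y).trans (add_le_add hx hy)) hxy (abs_nonneg _)
          (by positivity)
    _ = 2 * κ * τ := by ring

theorem telescopeLE_time_correction {p c τ : ℤ → ℝ} {κ : ℝ} (hs : SqSummable p)
    (hp : ∀ j, 0 ≤ p j) (hc : ∀ j, |c j| ≤ κ) (hτ : ∀ j, 0 ≤ τ j)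
    (hcτ : ∀ j, 0 < p j → |c (j + 1) - c j| ≤ τ j) :
    TelescopeLE
      (fun j => c j ^ 2 * (p j - p (j - 1)) ^ 2
        - 4 * c j ^ 2 * recon p j * (p (j + 1) - p (j - 1)))
      (fun j => 2 * κ ^ 2 * dissip p j + κ ^ 2 * (rise p j * fall p (j + 1))
        + (1 / 4 * (2 * κ * τ (j - 1) * p j ^ 2)
          + 3 / 4 * (2 * κ * τ (j - 1) * p (j - 1) ^ 2))) := by
  have hκ : 0 ≤ κ := (abs_nonneg _).trans (hc 0)
  have hr := sqSummable_rise hs hp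
  have hf := sqSummable_fall hs hp
  have hc' : ∀ j, |c (j - 1)| ≤ κ := fun j => hc _
  have hcκ : ∀ j, c j ^ 2 ≤ κ ^ 2 := fun j => sq_le_sq.2 ((hc j).trans (le_abs_self κ))
  refine ⟨fun j => 1 / 4 * (c (j - 1) * rise p j) ^ 2 + 3 / 4 * (c (j - 1) * fall p j) ^ 2
      - 1 / 4 * (κ * (rise p j - rise p (j - 1))) ^ 2,
    ((Summable.mul_left _ (hr.bdd_mul hc')).add (Summable.mul_left _ (hf.bdd_mul hc'))).sub
      (Summable.mul_left _ ((hr.sub (hr.shift (-1))).const_mul κ)), fun j => ?_⟩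
  have hτ' := hτ (j - 1)
  have hgap (h : 0 < p (j - 1)) : c j ^ 2 - c (j - 1) ^ 2 ≤ 2 * κ * τ (j - 1) :=
    sq_sub_sq_le (hc j) (hc _) (by simpa only [sub_add_cancel] using hcτ (j - 1) h)
  have hrise : (c j ^ 2 - c (j - 1) ^ 2) * rise p j ^ 2
      ≤ κ ^ 2 * (rise p j - rise p (j - 1)) ^ 2 + 2 * κ * τ (j - 1) * p j ^ 2 := by
    rcases (hp (j - 1)).eq_or_lt with h | h
    · have hz : rise p (j - 1) = 0 := le_antisymm (h ▸ rise_le hp _) (rise_nonneg _ _)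
      rw [hz, sub_zero]
      have : c j ^ 2 - c (j - 1) ^ 2 ≤ κ ^ 2 := (sub_le_self _ (sq_nonneg _)).trans (hcκ j)
      exact (mul_le_mul_of_nonneg_right this (sq_nonneg _)).trans
        (le_add_of_nonneg_right (by positivity))
    · exact (mul_sq_le_of_pos (fun _ => hgap h) (by positivity) (rise_nonneg p j) (rise_le hp j)
        le_rfl).trans (le_add_of_nonneg_left (by positivity))
  have hfall : (c j ^ 2 - c (j - 1) ^ 2) * fall p j ^ 2 ≤ 2 * κ * τ (j - 1) * p (j - 1) ^ 2 :=
    mul_sq_le_of_pos hgap (by positivity) (fall_nonneg p j) (fall_le hp j) le_rfl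
  simp only [recon, dissip, add_sub_cancel_right]
  rw [succ_sub_pred_eq, ← rise_sub_fall]
  exact time_correction_pointwise (hcκ j) (rise_nonneg p j) (fall_nonneg p _) (rise_mul_fall p j)
    (rise_mul_fall p _) hrise hfall

theorem cross_pointwise {w' w w₁ κ S T am a b bp : ℝ} (hw : |w| ≤ κ) (hw₁ : |w₁| ≤ κ)
    (hab : 0 ≤ a * bp) (hS : (w - w₁) * a ^ 2 ≤ S) (hT : (w' - w) * b ^ 2 ≤ T) :
    2 * w * (a - b) * (1 / 8 * (a - bp) - 1 / 8 * (am - b))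
    ≤ κ / 8 * ((a - am) ^ 2 + (bp - b) ^ 2) + κ / 2 * (a * bp) + 1 / 8 * (S + T)
      + ((-(1 / 8) * (w * am * am) - 1 / 8 * (w' * b * b) + 1 / 4 * (w * am * b))
        - (-(1 / 8) * (w₁ * a * a) - 1 / 8 * (w * bp * bp) + 1 / 4 * (w₁ * a * bp))) := by
  have ⟨hw_neg, hw_pos⟩ := abs_le.1 hw
  have hrise : w * (a - am) ^ 2 ≤ κ * (a - am) ^ 2 := by gcongr
  have hfall : -w * (bp - b) ^ 2 ≤ κ * (bp - b) ^ 2 := by gcongr; linarith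
  have hpeak : (w₁ - w) * (a * bp) ≤ (2 * κ) * (a * bp) := by
    gcongr; linarith [(abs_le.1 hw₁).2]
  linear_combination
    (1 / 8) * hS + (1 / 8) * hT + (1 / 8) * hrise + (1 / 8) * hfall + (1 / 4) * hpeak

theorem telescopeLE_cross {p w μ : ℤ → ℝ} {κ W : ℝ} (hs : SqSummable p) (hp : ∀ j, 0 ≤ p j)
    (hW : ∀ j, p j ≤ W) (hw : ∀ j, |w j| ≤ κ) (hμ : ∀ j, 0 ≤ μ j) (hμs : Summable μ)
    (hmono : ∀ j, 0 < p j → -μ j ≤ w (j + 1) - w j) :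
    TelescopeLE
      (fun j => 2 * w j * (p j - p (j - 1)) * (recon p j - recon p (j - 1)))
      (fun j => κ / 8 * dissip p j + κ / 2 * (rise p j * fall p (j + 1))
        + 1 / 4 * (W ^ 2 * μ j)) := by
  have hf := sqSummable_fall hs hp
  have hr' := (sqSummable_rise hs hp).shift (-1)
  have hw' : ∀ j, |w (j - 1)| ≤ κ := fun j => hw _
  refine ⟨fun j => (-(1 / 8) * (w j * rise p (j - 1) * rise p (j - 1))
      - 1 / 8 * (w (j - 1) * fall p j * fall p j) + 1 / 4 * (w j * rise p (j - 1) * fall p j))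
      + 1 / 8 * W ^ 2 * μ (j - 1),
    (((((hr'.bdd_mul hw).mul hr').mul_left _).sub (((hf.bdd_mul hw').mul hf).mul_left _)).add
      (((hr'.bdd_mul hw).mul hf).mul_left _)).add ((summable_int_shift hμs (-1)).mul_left _),
    fun j => ?_⟩
  have hrise : (w j - w (j + 1)) * rise p j ^ 2 ≤ μ j * W ^ 2 :=
    mul_sq_le_of_pos (fun h => by linarith [hmono j h]) (hμ j) (rise_nonneg p j) (rise_le hp j)
      (hW j)
  have hfall : (w (j - 1) - w j) * fall p j ^ 2 ≤ μ (j - 1) * W ^ 2 := by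
    refine mul_sq_le_of_pos (fun h => ?_) (hμ _) (fall_nonneg p j) (fall_le hp j) (hW _)
    have := hmono (j - 1) h
    rw [sub_add_cancel] at this
    linarith
  simp only [recon, dissip, add_sub_cancel_right, sub_add_cancel]
  rw [← rise_sub_fall]
  linarith [cross_pointwise (am := rise p (j - 1)) (hw j) (hw (j + 1))
    (rise_mul_fall_succ_nonneg p j) hrise hfall]

/-! ### One-sided stability of an abstract step -/

theorem abs_mul_one_sub_le {x : ℝ} (hx : |x| ≤ 1 / 2) : |x * (1 - 4 * x ^ 2)| ≤ |x| := by
  have hsq : x ^ 2 ≤ (1 / 2) ^ 2 := sq_le_sq.2 (hx.trans (le_abs_self _))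
  rw [abs_mul]
  refine mul_le_of_le_one_right (abs_nonneg x) (abs_le.2 ⟨?_, ?_⟩) <;> linarith [sq_nonneg x]

theorem neg_le_mul_one_sub_sub {x y m : ℝ} (hx : |x| ≤ 1 / 4) (hy : |y| ≤ 1 / 4) (hm : 0 ≤ m)
    (hxy : -m ≤ y - x) : -m ≤ y * (1 - 4 * y ^ 2) - x * (1 - 4 * x ^ 2) := by
  have hx2 : x ^ 2 ≤ (1 / 4) ^ 2 := sq_le_sq.2 (hx.trans (le_abs_self _))
  have hy2 : y ^ 2 ≤ (1 / 4) ^ 2 := sq_le_sq.2 (hy.trans (le_abs_self _))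
  set q := x ^ 2 + x * y + y ^ 2
  have hq₀ : 0 ≤ q := by linarith [sq_nonneg (x + y), sq_nonneg x, sq_nonneg y]
  have hq₁ : 4 * q ≤ 1 := by linarith [sq_nonneg (x - y)]
  calc -m ≤ -(m * (1 - 4 * q)) := by linarith [mul_nonneg hm hq₀]
    _ = -m * (1 - 4 * q) := by ring
    _ ≤ (y - x) * (1 - 4 * q) := by gcongr
    _ = y * (1 - 4 * y ^ 2) - x * (1 - 4 * x ^ 2) := by ring

theorem sq_perturbed_le {c E D z κ T M : ℝ} (hc : |c| ≤ κ) (hκ : κ ≤ 1 / 4000)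
    (hD : |D| ≤ M) (hT : 0 ≤ T) (hTκ : T ≤ 2 * κ) (hz : |z| ≤ 41 / 20 * (T * M)) :
    ((1 - 4 * c ^ 2) * E + c * D + z) ^ 2
      ≤ 5 / 4 * E ^ 2 + 2 * (c * (1 - 4 * c ^ 2)) * D * E + c ^ 2 * D ^ 2
        + 47 * (κ * T * M ^ 2) := by
  have hκ₀ : 0 ≤ κ := (abs_nonneg _).trans hc
  have hM : 0 ≤ M := (abs_nonneg _).trans hD
  have hc2 : c ^ 2 ≤ (1 / 4000) ^ 2 := sq_le_sq.2 ((hc.trans hκ).trans (le_abs_self _))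
  have hfac : (1 - 4 * c ^ 2) ^ 2 ≤ 1 := by nlinarith [sq_nonneg c]
  have hz2 : z ^ 2 ≤ (41 / 20) ^ 2 * (2 * κ * T * M ^ 2) :=
    calc z ^ 2 ≤ (41 / 20 * (T * M)) ^ 2 := sq_le_sq.2 (hz.trans (le_abs_self _))
      _ = (41 / 20) ^ 2 * (T * T * M ^ 2) := by ring
      _ ≤ (41 / 20) ^ 2 * (2 * κ * T * M ^ 2) := by gcongr
  have hcDz : c * D * z ≤ 41 / 20 * (κ * T * M ^ 2) :=
    calc c * D * z ≤ |c| * |D| * |z| := by rw [← abs_mul, ← abs_mul]; exact le_abs_self _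
      _ ≤ κ * M * (41 / 20 * (T * M)) := by gcongr
      _ = 41 / 20 * (κ * T * M ^ 2) := by ring
  have hEz : 2 * ((1 - 4 * c ^ 2) * E) * z ≤ 1 / 4 * ((1 - 4 * c ^ 2) ^ 2 * E ^ 2) + 4 * z ^ 2 := by
    linarith [sq_nonneg ((1 - 4 * c ^ 2) * E - 4 * z)]
  have hE : (1 - 4 * c ^ 2) ^ 2 * E ^ 2 ≤ 1 * E ^ 2 := by gcongr
  have hpos : 0 ≤ κ * T * M ^ 2 := by positivity
  linarith

/-- The bound for the differences of wave speeds across the jump `p j`: the speeds themselves are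
bounded by `κ`, and they vary by at most `Λ` times the jump plus a contribution `μ j` of the
discontinuous coefficient. -/
noncomputable def speedGap (κ Λ : ℝ) (p μ : ℤ → ℝ) (j : ℤ) : ℝ := min (2 * κ) (Λ * p j + μ j)

/-- The largest of the three consecutive jumps around `p j`. -/
noncomputable def localMax (p : ℤ → ℝ) (j : ℤ) : ℝ := max (p (j - 1)) (max (p j) (p (j + 1)))

/-- The size, up to a numerical factor, of the terms of an abstract step that are cubic in the
jumps and not part of `leading`. -/
noncomputable def localError (κ Λ : ℝ) (p μ : ℤ → ℝ) (j : ℤ) : ℝ :=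
  κ * max (speedGap κ Λ p μ (j - 1)) (speedGap κ Λ p μ j) * localMax p j ^ 2

/-- The leading part of the change of `∑ p j ^ 2` in an abstract step: all wave speeds are frozen at
`c j`, except in the transport term, where the mean speed `v j` produces the cubic gain. -/
noncomputable def leading (p c v : ℤ → ℝ) (j : ℤ) : ℝ :=
  recon p j * (p (j + 1) - p (j - 1)) + v j * p j * (p (j + 1) - p (j - 1))
    - 4 * c j ^ 2 * recon p j * (p (j + 1) - p (j - 1))
    + 5 / 4 * (recon p j - recon p (j - 1)) ^ 2
    + 2 * (c j * (1 - 4 * c j ^ 2)) * (p j - p (j - 1)) * (recon p j - recon p (j - 1))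
    + c j ^ 2 * (p j - p (j - 1)) ^ 2

/-- Abstract step of a central scheme for a convex flux: `p` is the sequence of positive jumps, `c`
the wave speeds in the cells, `v` the mean speeds over the jumps, `φ` the flux differences over the
jumps, `μ` the effect of the coefficient on the speeds, `κ` the Courant number, `W` a bound for the
jumps, and `g ≤ f'' ≤ Λ` up to the factor `Δt / Δx`. -/
structure ConvexStep (p c v φ μ : ℤ → ℝ) (κ g Λ W : ℝ) : Prop where
  p_nonneg : ∀ j, 0 ≤ p j
  p_le : ∀ j, p j ≤ W
  sqSummable_p : SqSummable p
  kappa_le : κ ≤ 1 / 4000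
  g_nonneg : 0 ≤ g
  Lambda_nonneg : 0 ≤ Λ
  kappa_mul_le : κ * Λ ≤ g / 7500
  g_mul_le : ∀ j, g * p j ≤ 1 / 6
  abs_c_le : ∀ j, |c j| ≤ κ
  abs_v_le : ∀ j, |v j| ≤ κ
  mu_nonneg : ∀ j, 0 ≤ μ j
  summable_mu : Summable μ
  v_sub_left : ∀ j, 0 < p j → |v j - c j| ≤ speedGap κ Λ p μ j
  v_sub_right : ∀ j, 0 < p j → |v j - c (j + 1)| ≤ speedGap κ Λ p μ j
  c_sub : ∀ j, 0 < p j → |c (j + 1) - c j| ≤ speedGap κ Λ p μ j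
  c_mono : ∀ j, 0 < p j → -μ j ≤ c (j + 1) - c j
  v_mono : ∀ j, 0 < p j → 0 < p (j + 1) → g / 2 * (p j + p (j + 1)) - μ j ≤ v (j + 1) - v j
  phi_sub : ∀ j, |φ j - (v j * p j - 4 * c j ^ 2 * recon p j)| ≤ 2 * κ * speedGap κ Λ p μ j * p j

theorem le_localMax (p : ℤ → ℝ) (j : ℤ) :
    p (j - 1) ≤ localMax p j ∧ p j ≤ localMax p j ∧ p (j + 1) ≤ localMax p j :=
  ⟨le_max_left _ _, (le_max_left _ _).trans (le_max_right _ _),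
    (le_max_right _ _).trans (le_max_right _ _)⟩

theorem localMax_cube_le {p : ℤ → ℝ} (hp : ∀ j, 0 ≤ p j) (j : ℤ) :
    localMax p j ^ 3 ≤ p (j - 1) ^ 3 + p j ^ 3 + p (j + 1) ^ 3 := by
  have h (i : ℤ) : 0 ≤ p i ^ 3 := pow_nonneg (hp i) 3
  unfold localMax
  rcases max_choice (p (j - 1)) (max (p j) (p (j + 1))) with e | e <;> rw [e]
  · linarith [h j, h (j + 1)]
  · rcases max_choice (p j) (p (j + 1)) with e | e <;> rw [e] <;>
      linarith [h (j - 1), h j, h (j + 1)]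

namespace ConvexStep

variable {p c v φ μ : ℤ → ℝ} {κ g Λ W : ℝ}

theorem kappa_nonneg (h : ConvexStep p c v φ μ κ g Λ W) : 0 ≤ κ :=
  (abs_nonneg _).trans (h.abs_c_le 0)

theorem speedGap_nonneg (h : ConvexStep p c v φ μ κ g Λ W) (j : ℤ) : 0 ≤ speedGap κ Λ p μ j :=
  le_min (mul_nonneg zero_le_two h.kappa_nonneg)
    (add_nonneg (mul_nonneg h.Lambda_nonneg (h.p_nonneg j)) (h.mu_nonneg j))

theorem localMax_nonneg (h : ConvexStep p c v φ μ κ g Λ W) (j : ℤ) : 0 ≤ localMax p j :=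
  (h.p_nonneg j).trans (le_localMax p j).2.1

theorem localMax_le (h : ConvexStep p c v φ μ κ g Λ W) (j : ℤ) : localMax p j ≤ W :=
  max_le (h.p_le _) (max_le (h.p_le _) (h.p_le _))

theorem summable_cube (h : ConvexStep p c v φ μ κ g Λ W) : Summable fun j => p j ^ 3 := by
  refine .of_nonneg_of_le (fun j => pow_nonneg (h.p_nonneg j) 3) (fun j => ?_)
    (Summable.mul_left W h.sqSummable_p)
  rw [pow_succ']
  exact mul_le_mul_of_nonneg_right (h.p_le j) (sq_nonneg _)

theorem abs_phi_le (h : ConvexStep p c v φ μ κ g Λ W) (j : ℤ) : |φ j| ≤ 1 / 8 * p j := by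
  have hp := h.p_nonneg j
  have := h.kappa_nonneg
  have hκ' := h.kappa_le
  have hτ := h.speedGap_nonneg j
  have htransport : |v j * p j| ≤ 1 / 4000 * p j := by
    rw [abs_mul, abs_of_nonneg hp]
    exact mul_le_mul_of_nonneg_right ((h.abs_v_le j).trans hκ') hp
  have hc : c j ^ 2 ≤ (1 / 4000) ^ 2 :=
    sq_le_sq.2 (((h.abs_c_le j).trans hκ').trans (le_abs_self _))
  have hrecon : |4 * c j ^ 2 * recon p j| ≤ 4 * (1 / 4000) ^ 2 * (1 / 8 * p j) := by
    rw [abs_mul, abs_of_nonneg (by positivity : 0 ≤ 4 * c j ^ 2)]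
    gcongr
    exact abs_recon_le h.p_nonneg j
  have herror : 2 * κ * speedGap κ Λ p μ j * p j ≤ 2 * (1 / 4000) * (2 * (1 / 4000)) * p j := by
    gcongr
    exact (min_le_left _ _).trans (by gcongr)
  have h_phi := h.phi_sub j
  rw [abs_le] at *
  constructor <;> linarith [h_phi.1, h_phi.2, htransport.1, htransport.2, hrecon.1, hrecon.2]

theorem sqSummable_recon_add_phi (h : ConvexStep p c v φ μ κ g Λ W) :
    SqSummable fun j => recon p j + φ j :=
  (sqSummable_recon h.sqSummable_p h.p_nonneg).add <| h.sqSummable_p.mono (1 / 8) fun j => by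
    rw [abs_of_nonneg (h.p_nonneg j)]; exact h.abs_phi_le j

theorem abs_phi_sub_le (h : ConvexStep p c v φ μ κ g Λ W) {j : ℤ} {T M : ℝ}
    (hτ : speedGap κ Λ p μ j ≤ T) (hM : p j ≤ M) :
    |φ j - (v j * p j - 4 * c j ^ 2 * recon p j)| ≤ 2 * (κ * T * M) := by
  have := h.kappa_nonneg
  have := h.p_nonneg j
  have := (h.speedGap_nonneg j).trans hτ
  calc _ ≤ 2 * κ * speedGap κ Λ p μ j * p j := h.phi_sub j
    _ ≤ 2 * κ * T * M := by gcongr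
    _ = 2 * (κ * T * M) := by ring

theorem abs_sq_sub_mul_recon_le (h : ConvexStep p c v φ μ κ g Λ W) {j : ℤ} {T M : ℝ}
    (hτ : speedGap κ Λ p μ j ≤ T) (hM : p j ≤ M) :
    |4 * (c (j + 1) ^ 2 - c j ^ 2) * recon p j| ≤ κ * T * M := by
  have hκ := h.kappa_nonneg
  have hsum : |c (j + 1) + c j| ≤ 2 * κ := by
    linarith [abs_add_le (c (j + 1)) (c j), h.abs_c_le j, h.abs_c_le (j + 1)]
  have hdiff : |c (j + 1) - c j| * p j ≤ T * M := by
    have := abs_mul_le_of_pos (fun hj => (h.c_sub j hj).trans hτ)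
      ((h.speedGap_nonneg j).trans hτ) (h.p_nonneg j) hM
    rwa [abs_mul, abs_of_nonneg (h.p_nonneg j)] at this
  calc |4 * (c (j + 1) ^ 2 - c j ^ 2) * recon p j|
      = 4 * |c (j + 1) + c j| * |c (j + 1) - c j| * |recon p j| := by
        rw [sq_sub_sq, ← mul_assoc, abs_mul, abs_mul, abs_mul, abs_of_pos (zero_lt_four' ℝ)]
    _ ≤ 4 * (2 * κ) * |c (j + 1) - c j| * (1 / 8 * p j) := by
        gcongr; exact abs_recon_le h.p_nonneg j
    _ = κ * (|c (j + 1) - c j| * p j) := by ring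
    _ ≤ κ * (T * M) := by gcongr
    _ = κ * T * M := by ring

theorem abs_flux_sub_le (h : ConvexStep p c v φ μ κ g Λ W) {j : ℤ} {T M : ℝ}
    (hτ : speedGap κ Λ p μ (j + 1) ≤ T) (hτ' : speedGap κ Λ p μ j ≤ T)
    (hM : p (j + 1) ≤ M) (hM' : p j ≤ M) :
    |recon p (j + 1) + φ (j + 1) - (recon p j + φ j)
        - ((1 - 4 * c (j + 1) ^ 2) * (recon p (j + 1) - recon p j)
          + c (j + 1) * (p (j + 1) - p j))| ≤ 41 / 20 * (T * M) := by
  have hT : 0 ≤ T := (h.speedGap_nonneg _).trans hτ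
  have hM₀ : 0 ≤ M := (h.p_nonneg _).trans hM
  have hright : |(v (j + 1) - c (j + 1)) * p (j + 1)| ≤ T * M :=
    abs_mul_le_of_pos (fun hj => (h.v_sub_left _ hj).trans hτ) hT (h.p_nonneg _) hM
  have hleft : |(v j - c (j + 1)) * p j| ≤ T * M :=
    abs_mul_le_of_pos (fun hj => (h.v_sub_right j hj).trans hτ') hT (h.p_nonneg j) hM'
  have hcorrection := h.abs_sq_sub_mul_recon_le hτ' hM'
  have hφ := h.abs_phi_sub_le hτ hM
  have hφ' := h.abs_phi_sub_le hτ' hM'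
  have hκ : κ * T * M ≤ 1 / 4000 * T * M := by gcongr; exact h.kappa_le
  rw [abs_le] at *
  constructor <;> linarith [hright.1, hright.2, hleft.1, hleft.2, hcorrection.1, hcorrection.2,
    hφ.1, hφ.2, hφ'.1, hφ'.2]

theorem flux_le_leading (h : ConvexStep p c v φ μ κ g Λ W) (j : ℤ) :
    (recon p j + φ j) * (p (j + 1) - p (j - 1))
        + (recon p j + φ j - (recon p (j - 1) + φ (j - 1))) ^ 2
      ≤ leading p c v j + 49 * localError κ Λ p μ j := by
  obtain ⟨hM₁, hM₂, hM₃⟩ := le_localMax p j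
  unfold localError leading
  set T := max (speedGap κ Λ p μ (j - 1)) (speedGap κ Λ p μ j)
  set M := localMax p j
  have hκ := h.kappa_nonneg
  have hM : 0 ≤ M := h.localMax_nonneg j
  have hT : 0 ≤ T := (h.speedGap_nonneg j).trans (le_max_right _ _)
  have hD : |p j - p (j - 1)| ≤ M := by
    rw [abs_le]; constructor <;> linarith [h.p_nonneg j, h.p_nonneg (j - 1)]
  have hD₂ : |p (j + 1) - p (j - 1)| ≤ M := by
    rw [abs_le]; constructor <;> linarith [h.p_nonneg (j + 1), h.p_nonneg (j - 1)]
  have hflux := h.abs_flux_sub_le (j := j - 1) (T := T) (M := M)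
  simp only [sub_add_cancel] at hflux
  have hsq := sq_perturbed_le (E := recon p j - recon p (j - 1)) (h.abs_c_le j) h.kappa_le hD hT
    (max_le (min_le_left _ _) (min_le_left _ _))
    (hflux (le_max_right _ _) (le_max_left _ _) hM₂ hM₁)
  have hφ : (φ j - (v j * p j - 4 * c j ^ 2 * recon p j)) * (p (j + 1) - p (j - 1))
      ≤ 2 * (κ * T * M ^ 2) :=
    calc _ ≤ |φ j - (v j * p j - 4 * c j ^ 2 * recon p j)| * |p (j + 1) - p (j - 1)| := by
          rw [← abs_mul]; exact le_abs_self _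
      _ ≤ 2 * (κ * T * M) * M := by gcongr; exact h.abs_phi_sub_le (le_max_right _ _) hM₂
      _ = 2 * (κ * T * M ^ 2) := by ring
  rw [add_sub_cancel] at hsq
  linarith

theorem localError_le (h : ConvexStep p c v φ μ κ g Λ W) (j : ℤ) :
    localError κ Λ p μ j ≤
      g / 7500 * (p (j - 1) ^ 3 + p j ^ 3 + p (j + 1) ^ 3)
        + W ^ 2 / 4000 * (μ (j - 1) + μ j + μ (j + 1)) := by
  obtain ⟨hM₁, hM₂, -⟩ := le_localMax p j
  have hκ := h.kappa_nonneg
  have hΛ := h.Lambda_nonneg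
  have hM := h.localMax_nonneg j
  have hμ := h.mu_nonneg
  have hT : max (speedGap κ Λ p μ (j - 1)) (speedGap κ Λ p μ j)
      ≤ Λ * localMax p j + (μ (j - 1) + μ j + μ (j + 1)) := by
    refine max_le ((min_le_right _ _).trans ?_) ((min_le_right _ _).trans ?_)
    · linarith [mul_le_mul_of_nonneg_left hM₁ hΛ, hμ j, hμ (j + 1)]
    · linarith [mul_le_mul_of_nonneg_left hM₂ hΛ, hμ (j - 1), hμ (j + 1)]
  have hm : 0 ≤ μ (j - 1) + μ j + μ (j + 1) := add_nonneg (add_nonneg (hμ _) (hμ _)) (hμ _)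
  calc localError κ Λ p μ j
      ≤ κ * (Λ * localMax p j + (μ (j - 1) + μ j + μ (j + 1))) * localMax p j ^ 2 := by
        unfold localError; gcongr
    _ = κ * Λ * localMax p j ^ 3 + κ * localMax p j ^ 2 * (μ (j - 1) + μ j + μ (j + 1)) := by ring
    _ ≤ g / 7500 * (p (j - 1) ^ 3 + p j ^ 3 + p (j + 1) ^ 3)
        + 1 / 4000 * W ^ 2 * (μ (j - 1) + μ j + μ (j + 1)) := by
        have := h.g_nonneg
        gcongr
        exacts [h.kappa_mul_le, localMax_cube_le h.p_nonneg j, h.kappa_le, h.localMax_le j]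
    _ = _ := by ring

theorem telescopeLE_localError (h : ConvexStep p c v φ μ κ g Λ W) :
    TelescopeLE (fun j => 51 * localError κ Λ p μ j)
      (fun j => 1 / 25 * g * p j ^ 3 + 1 / 25 * (W ^ 2 * μ j)) := by
  have hN : Summable fun j => 51 * (g / 7500 * p j ^ 3 + W ^ 2 / 4000 * μ j) :=
    ((h.summable_cube.mul_left _).add (h.summable_mu.mul_left _)).mul_left _
  refine (TelescopeLE.of_le fun j => ?_).trans ((telescopeLE_neighbor_sum hN).trans
    (TelescopeLE.of_le fun j => ?_))
  · linarith [h.localError_le j]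
  · have hcube : 0 ≤ g * p j ^ 3 := mul_nonneg h.g_nonneg (pow_nonneg (h.p_nonneg j) 3)
    have hcoeff : 0 ≤ W ^ 2 * μ j := mul_nonneg (sq_nonneg _) (h.mu_nonneg j)
    linarith

theorem time_remainder_le (h : ConvexStep p c v φ μ κ g Λ W) (j : ℤ) :
    1 / 4 * (2 * κ * speedGap κ Λ p μ (j - 1) * p j ^ 2)
      + 3 / 4 * (2 * κ * speedGap κ Λ p μ (j - 1) * p (j - 1) ^ 2) ≤ 2 * localError κ Λ p μ j := by
  have hκ := h.kappa_nonneg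
  have hT := h.speedGap_nonneg (j - 1)
  have hbound {i : ℤ} (hi : p i ≤ localMax p j) :
      2 * κ * speedGap κ Λ p μ (j - 1) * p i ^ 2 ≤ 2 * localError κ Λ p μ j := by
    have := h.p_nonneg i
    rw [localError, ← mul_assoc, ← mul_assoc]
    gcongr
    exact le_max_left _ _
  linarith [hbound (le_localMax p j).1, hbound (le_localMax p j).2.1]

theorem telescopeLE_leading (h : ConvexStep p c v φ μ κ g Λ W) :
    TelescopeLE (fun j => leading p c v j - 1 / 4 * (p j - p (j - 1)) ^ 2)
      (fun j => -(3 / 16) * g * p j ^ 3 + 5 / 4 * (W ^ 2 * μ j) + 2 * localError κ Λ p μ j) := by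
  have hs := h.sqSummable_p
  have hp := h.p_nonneg
  have hκ := h.kappa_nonneg
  have hc (j : ℤ) : |c j| ≤ 1 / 4 := by linarith [h.abs_c_le j, h.kappa_le]
  have hw (j : ℤ) : |c j * (1 - 4 * c j ^ 2)| ≤ κ :=
    (abs_mul_one_sub_le (by linarith [hc j])).trans (h.abs_c_le j)
  have hw_mono (j : ℤ) (hj : 0 < p j) :
      -μ j ≤ c (j + 1) * (1 - 4 * c (j + 1) ^ 2) - c j * (1 - 4 * c j ^ 2) :=
    neg_le_mul_one_sub_sub (hc j) (hc (j + 1)) (h.mu_nonneg j) (h.c_mono j hj)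
  have hdissipation := telescopeLE_minmod_dissipation hs hp
  have htransport := telescopeLE_transport hs hp h.p_le h.abs_v_le h.mu_nonneg h.v_mono
  have htime := telescopeLE_time_correction hs hp h.abs_c_le h.speedGap_nonneg h.c_sub
  have hcross := telescopeLE_cross hs hp h.p_le hw h.mu_nonneg h.summable_mu hw_mono
  have hgain := telescopeLE_cubic_gain hs hp h.p_le h.g_nonneg h.g_mul_le
  obtain ⟨H, hH, hle⟩ := (((hdissipation.add htransport).add htime).add hcross).add hgain
  refine ⟨H, hH, fun j => ?_⟩
  have hκ2 : κ ^ 2 ≤ 1 / 4000 := by nlinarith [h.kappa_le]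
  have hdissip : (2 * κ ^ 2 + κ / 8) * dissip p j ≤ 1 / 1000 * dissip p j := by
    have := dissip_nonneg p j
    gcongr; linarith [h.kappa_le]
  have hpeak : (κ ^ 2 + κ / 2) * (rise p j * fall p (j + 1))
      ≤ 1 / 1000 * (rise p j * fall p (j + 1)) := by
    have := rise_mul_fall_succ_nonneg p j
    gcongr; linarith [h.kappa_le]
  unfold leading
  linarith [hle j, sq_recon_sub_le p j, dissip_nonneg p j, rise_mul_fall_succ_nonneg p j,
    h.time_remainder_le j]

theorem telescopeLE_sq (h : ConvexStep p c v φ μ κ g Λ W) :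
    TelescopeLE
      (fun j => (1 / 2 * (p (j - 1) + p j)
        - (recon p j + φ j - (recon p (j - 1) + φ (j - 1)))) ^ 2)
      (fun j => p j ^ 2 - 1 / 500 * g * p j ^ 3 + 2 * (W ^ 2 * μ j)) := by
  have haverage := telescopeLE_sq_average h.sqSummable_p h.sqSummable_recon_add_phi
  obtain ⟨H, hH, hle⟩ := (haverage.add h.telescopeLE_leading).add h.telescopeLE_localError
  refine ⟨H, hH, fun j => ?_⟩
  have hcube : 0 ≤ g * p j ^ 3 := mul_nonneg h.g_nonneg (pow_nonneg (h.p_nonneg j) 3)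
  have hcoeff : 0 ≤ W ^ 2 * μ j := mul_nonneg (sq_nonneg _) (h.mu_nonneg j)
  linarith [hle j, h.flux_le_leading j]

end ConvexStep

/-! ### Lipschitz families of convex fluxes -/

/-- A family `f k`, `k ∈ K`, of uniformly convex fluxes on `[ulo, uhi]` with speeds bounded by `A`,
which depends on `k` in a Lipschitz way, with constants `L` for the flux and `M` for the speed.
Both `γ₁ ≤ f_uu` and `f_uu ≤ γ₂` are expressed by increments of the speed `f_u = partialU _ f`, so
that no second derivative has to exist. -/
structure IsLipschitzConvexFlux (K : Set ℝ) (ulo uhi γ₁ γ₂ A L M : ℝ) (f : ℝ → ℝ → ℝ) : Prop where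
  gamma₁_nonneg : 0 ≤ γ₁
  gamma₂_nonneg : 0 ≤ γ₂
  differentiableOn : ∀ k ∈ K, DifferentiableOn ℝ (f k) (Icc ulo uhi)
  mul_le_partialU_sub : ∀ k ∈ K, ∀ x ∈ Icc ulo uhi, ∀ y ∈ Icc ulo uhi, x ≤ y →
    γ₁ * (y - x) ≤ partialU (Icc ulo uhi) f k y - partialU (Icc ulo uhi) f k x
  partialU_sub_le_mul : ∀ k ∈ K, ∀ x ∈ Icc ulo uhi, ∀ y ∈ Icc ulo uhi, x ≤ y →
    partialU (Icc ulo uhi) f k y - partialU (Icc ulo uhi) f k x ≤ γ₂ * (y - x)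
  abs_partialU_le : ∀ k ∈ K, ∀ u ∈ Icc ulo uhi, |partialU (Icc ulo uhi) f k u| ≤ A
  flux_lipschitz : ∀ k ∈ K, ∀ k' ∈ K, ∀ u ∈ Icc ulo uhi, |f k' u - f k u| ≤ L * |k' - k|
  speed_lipschitz : ∀ k ∈ K, ∀ k' ∈ K, ∀ u ∈ Icc ulo uhi,
    |partialU (Icc ulo uhi) f k' u - partialU (Icc ulo uhi) f k u| ≤ M * |k' - k|

theorem exists_sub_eq_derivWithin_mul {g : ℝ → ℝ} {s : Set ℝ} (hs : Convex ℝ s)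
    (hg : DifferentiableOn ℝ g s) {x y : ℝ} (hx : x ∈ s) (hy : y ∈ s) :
    ∃ t ∈ uIcc x y, g y - g x = derivWithin g s t * (y - x) := by
  obtain ⟨t, ht, h⟩ :=
    domain_mvt (fun t ht => (hg t ht).hasDerivWithinAt.hasFDerivWithinAt) hs hx hy
  refine ⟨t, segment_eq_uIcc x y ▸ ht, h.trans ?_⟩
  rw [ContinuousLinearMap.toSpanSingleton_apply, smul_eq_mul, mul_comm]

namespace IsLipschitzConvexFlux

variable {K : Set ℝ} {ulo uhi γ₁ γ₂ A L M : ℝ} {f : ℝ → ℝ → ℝ} {k k' x y z : ℝ}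

theorem const_mul (hf : IsLipschitzConvexFlux K ulo uhi γ₁ γ₂ A L M f) {lam : ℝ}
    (hlam : 0 ≤ lam) :
    IsLipschitzConvexFlux K ulo uhi (lam * γ₁) (lam * γ₂) (lam * A) (lam * L) (lam * M)
      (fun k u => lam * f k u) := by
  have hpartial (k u : ℝ) : partialU (Icc ulo uhi) (fun k u => lam * f k u) k u
      = lam * partialU (Icc ulo uhi) f k u := derivWithin_const_mul_field lam
  refine ⟨mul_nonneg hlam hf.gamma₁_nonneg, mul_nonneg hlam hf.gamma₂_nonneg,
    fun k hk => (hf.differentiableOn k hk).const_mul lam, fun k hk x hx y hy hxy => ?_,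
    fun k hk x hx y hy hxy => ?_, fun k hk u hu => ?_, fun k hk k' hk' u hu => ?_,
    fun k hk k' hk' u hu => ?_⟩
  all_goals simp only [hpartial, mul_assoc, ← mul_sub, abs_mul, abs_of_nonneg hlam]
  all_goals refine mul_le_mul_of_nonneg_left ?_ hlam
  exacts [hf.mul_le_partialU_sub k hk x hx y hy hxy, hf.partialU_sub_le_mul k hk x hx y hy hxy,
    hf.abs_partialU_le k hk u hu, hf.flux_lipschitz k hk k' hk' u hu,
    hf.speed_lipschitz k hk k' hk' u hu]

theorem exists_sub_eq_partialU_mul (hf : IsLipschitzConvexFlux K ulo uhi γ₁ γ₂ A L M f)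
    (hk : k ∈ K) (hx : x ∈ Icc ulo uhi) (hy : y ∈ Icc ulo uhi) :
    ∃ t ∈ Icc ulo uhi, t ∈ uIcc x y ∧
      f k y - f k x = partialU (Icc ulo uhi) f k t * (y - x) := by
  obtain ⟨t, ht, h⟩ :=
    exists_sub_eq_derivWithin_mul (convex_Icc ulo uhi) (hf.differentiableOn k hk) hx hy
  exact ⟨t, uIcc_subset_Icc hx hy ht, ht, h⟩

theorem abs_sub_le_mul (hf : IsLipschitzConvexFlux K ulo uhi γ₁ γ₂ A L M f) (hk : k ∈ K)
    (hx : x ∈ Icc ulo uhi) (hy : y ∈ Icc ulo uhi) : |f k y - f k x| ≤ A * |y - x| := by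
  obtain ⟨t, ht, -, h⟩ := hf.exists_sub_eq_partialU_mul hk hx hy
  rw [h, abs_mul]
  exact mul_le_mul_of_nonneg_right (hf.abs_partialU_le k hk t ht) (abs_nonneg _)

theorem abs_slope_le (hf : IsLipschitzConvexFlux K ulo uhi γ₁ γ₂ A L M f) (hk : k ∈ K)
    (hx : x ∈ Icc ulo uhi) (hy : y ∈ Icc ulo uhi) : |slope (f k) x y| ≤ A := by
  rw [slope_def_field, abs_div]
  exact div_le_of_le_mul₀ (abs_nonneg _) ((abs_nonneg _).trans (hf.abs_partialU_le k hk x hx))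
    (hf.abs_sub_le_mul hk hx hy)

theorem abs_partialU_sub_le_min (hf : IsLipschitzConvexFlux K ulo uhi γ₁ γ₂ A L M f)
    (hk : k ∈ K) (hk' : k' ∈ K) (hx : x ∈ Icc ulo uhi) (hy : y ∈ Icc ulo uhi) :
    |partialU (Icc ulo uhi) f k' y - partialU (Icc ulo uhi) f k x|
      ≤ min (2 * A) (γ₂ * |y - x| + M * |k' - k|) := by
  refine le_min ?_ ?_
  · linarith [abs_sub (partialU (Icc ulo uhi) f k' y) (partialU (Icc ulo uhi) f k x),
      hf.abs_partialU_le k' hk' y hy, hf.abs_partialU_le k hk x hx]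
  · have hstate : |partialU (Icc ulo uhi) f k y - partialU (Icc ulo uhi) f k x| ≤ γ₂ * |y - x| := by
      wlog hxy : x ≤ y generalizing x y
      · rw [abs_sub_comm, abs_sub_comm y]; exact this hy hx (le_of_not_ge hxy)
      have hmono : 0 ≤ γ₁ * (y - x) := mul_nonneg hf.gamma₁_nonneg (sub_nonneg.2 hxy)
      rw [abs_of_nonneg (sub_nonneg.2 hxy),
        abs_of_nonneg (hmono.trans (hf.mul_le_partialU_sub k hk x hx y hy hxy))]
      exact hf.partialU_sub_le_mul k hk x hx y hy hxy
    rw [add_comm]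
    exact (abs_sub_le _ (partialU (Icc ulo uhi) f k y) _).trans
      (add_le_add (hf.speed_lipschitz k hk k' hk' y hy) hstate)

theorem abs_sub_sub_partialU_mul_le (hf : IsLipschitzConvexFlux K ulo uhi γ₁ γ₂ A L M f)
    (hk : k ∈ K) (hx : x ∈ Icc ulo uhi) (hy : y ∈ Icc ulo uhi) :
    |f k y - f k x - partialU (Icc ulo uhi) f k x * (y - x)|
      ≤ min (2 * A) (γ₂ * |y - x|) * |y - x| := by
  obtain ⟨t, ht, htxy, h⟩ := hf.exists_sub_eq_partialU_mul hk hx hy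
  have hspeed := hf.abs_partialU_sub_le_min hk hk hx ht
  rw [sub_self, abs_zero, mul_zero, add_zero] at hspeed
  have := hf.gamma₂_nonneg
  rw [h, ← sub_mul, abs_mul]
  gcongr
  refine hspeed.trans ?_
  gcongr min _ (_ * ?_)
  exact abs_sub_left_of_mem_uIcc htxy

theorem abs_slope_sub_partialU_le (hf : IsLipschitzConvexFlux K ulo uhi γ₁ γ₂ A L M f)
    (hk : k ∈ K) (hk' : k' ∈ K) (hx : x ∈ Icc ulo uhi) (hy : y ∈ Icc ulo uhi) (hxy : x < y)
    (hz : z ∈ Icc x y) :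
    |slope (f k) x y - partialU (Icc ulo uhi) f k' z|
      ≤ min (2 * A) (γ₂ * (y - x) + M * |k' - k|) := by
  obtain ⟨t, ht, htxy, h⟩ := hf.exists_sub_eq_partialU_mul hk hx hy
  rw [uIcc_of_le hxy.le] at htxy
  have := hf.gamma₂_nonneg
  rw [slope_def_field, h, mul_div_cancel_right₀ _ (sub_pos.2 hxy).ne']
  refine (hf.abs_partialU_sub_le_min hk' hk ⟨hx.1.trans hz.1, hz.2.trans hy.2⟩ ht).trans ?_
  rw [abs_sub_comm k]
  gcongr
  rw [abs_le]
  constructor <;> linarith [htxy.1, htxy.2, hz.1, hz.2]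

theorem slope_mem_Icc (hf : IsLipschitzConvexFlux K ulo uhi γ₁ γ₂ A L M f) (hk : k ∈ K)
    (hx : x ∈ Icc ulo uhi) (hy : y ∈ Icc ulo uhi) (hxy : x < y) :
    slope (f k) x y ∈ Icc (partialU (Icc ulo uhi) f k x + γ₁ / 2 * (y - x))
      (partialU (Icc ulo uhi) f k y - γ₁ / 2 * (y - x)) := by
  have hpos := sub_pos.2 hxy
  have hquad (v : ℝ) : HasDerivAt (fun v => γ₁ / 2 * v ^ 2) (γ₁ * v) v :=
    ((hasDerivAt_pow 2 v).const_mul (γ₁ / 2)).congr_deriv (by norm_num; ring)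
  obtain ⟨t, ht, h⟩ := domain_mvt (f := fun v => f k v - γ₁ / 2 * v ^ 2)
    (fun v hv => (((hf.differentiableOn k hk) v hv).hasDerivWithinAt.sub
      (hquad v).hasDerivWithinAt).hasFDerivWithinAt) (convex_Icc ulo uhi) hx hy
  rw [segment_eq_uIcc] at ht
  have htU := uIcc_subset_Icc hx hy ht
  rw [uIcc_of_le hxy.le] at ht
  have hleft := hf.mul_le_partialU_sub k hk x hx t htU ht.1
  have hright := hf.mul_le_partialU_sub k hk t htU y hy ht.2
  rw [ContinuousLinearMap.toSpanSingleton_apply, smul_eq_mul] at h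
  have hslope : slope (f k) x y
      = partialU (Icc ulo uhi) f k t - γ₁ * t + γ₁ / 2 * (x + y) := by
    rw [slope_def_field, div_eq_iff hpos.ne']
    change _ = (derivWithin (f k) _ t - _ + _) * _
    linarith
  rw [hslope]
  constructor <;> linarith

end IsLipschitzConvexFlux

/-! ### The minmod limiter -/

theorem sign_mul_mem_uIcc {a m : ℝ} (hm : 0 ≤ m) (hma : m ≤ |a|) :
    Real.sign a * m ∈ uIcc 0 a := by
  rcases lt_trichotomy a 0 with ha | rfl | ha
  · rw [Real.sign_of_neg ha, neg_one_mul, uIcc_of_ge ha.le]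
    rw [abs_of_neg ha] at hma
    constructor <;> linarith
  · rw [Real.sign_zero, zero_mul]; exact left_mem_uIcc
  · rw [Real.sign_of_pos ha, one_mul, uIcc_of_le ha.le]
    exact ⟨hm, hma.trans (abs_of_pos ha).le⟩

theorem minmod_mem_uIcc_left (a b c : ℝ) : minmod a b c ∈ uIcc 0 a := by
  unfold minmod
  split_ifs
  · exact sign_mul_mem_uIcc (by positivity) (min_le_left _ _)
  · exact left_mem_uIcc

theorem minmod_mem_uIcc_right (a b c : ℝ) : minmod a b c ∈ uIcc 0 c := by
  unfold minmod
  split_ifs with h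
  · rw [h.1.trans h.2]
    exact sign_mul_mem_uIcc (by positivity) ((min_le_right _ _).trans (min_le_right _ _))
  · exact left_mem_uIcc

theorem minmod_of_pos {a b c : ℝ} (ha : 0 < a) (hb : 0 < b) (hc : 0 < c) :
    minmod a b c = min a (min b c) := by
  rw [minmod, Real.sign_of_pos ha, Real.sign_of_pos hb, Real.sign_of_pos hc, abs_of_pos ha,
    abs_of_pos hb, abs_of_pos hc, if_pos ⟨rfl, rfl⟩, one_mul]

/-- The positive part of the jump of `u` between the cells `j` and `j + 1`. -/
noncomputable def upJump (u : ℤ → ℝ) (j : ℤ) : ℝ := (u (j + 1) - u j)⁺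

section Slope

variable {u : ℤ → ℝ} {j : ℤ}

theorem upJump_nonneg (u : ℤ → ℝ) (j : ℤ) : 0 ≤ upJump u j := posPart_nonneg _

theorem upJump_sub_one (u : ℤ → ℝ) (j : ℤ) : upJump u (j - 1) = rise u j := by
  rw [upJump, rise, sub_add_cancel]

theorem upJump_eq_sub (h : 0 < upJump u j) : upJump u j = u (j + 1) - u j :=
  posPart_eq_self.2 (posPart_pos_iff.1 h).le

theorem upJump_add_le {a b : ℝ} (hu : ∀ j, u j ∈ Icc a b) (j : ℤ) :
    upJump u (j - 1) + upJump u j ≤ b - a := by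
  have hleft := hu (j - 1)
  have hmid := hu j
  have hright := hu (j + 1)
  rw [upJump, upJump, posPart_def, posPart_def, sub_add_cancel]
  rcases max_choice (u j - u (j - 1)) 0 with h | h <;>
    rcases max_choice (u (j + 1) - u j) 0 with h' | h' <;> rw [h, h'] <;>
    linarith [hleft.1, hleft.2, hmid.1, hmid.2, hright.1, hright.2]

theorem upJump_le {a b : ℝ} (hu : ∀ j, u j ∈ Icc a b) (j : ℤ) : upJump u j ≤ b - a :=
  (le_add_of_nonneg_left (upJump_nonneg u (j - 1))).trans (upJump_add_le hu j)

theorem mmSlope_mem_uIcc_right (u : ℤ → ℝ) (j : ℤ) : mmSlope u j ∈ uIcc 0 (u (j + 1) - u j) :=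
  minmod_mem_uIcc_left _ _ _

theorem mmSlope_mem_uIcc_left (u : ℤ → ℝ) (j : ℤ) : mmSlope u j ∈ uIcc 0 (u j - u (j - 1)) :=
  minmod_mem_uIcc_right _ _ _

theorem abs_mmSlope_le_right (u : ℤ → ℝ) (j : ℤ) : |mmSlope u j| ≤ |u (j + 1) - u j| := by
  simpa only [sub_zero] using abs_sub_left_of_mem_uIcc (mmSlope_mem_uIcc_right u j)

theorem abs_mmSlope_le_left (u : ℤ → ℝ) (j : ℤ) : |mmSlope u j| ≤ |u j - u (j - 1)| := by
  simpa only [sub_zero] using abs_sub_left_of_mem_uIcc (mmSlope_mem_uIcc_left u j)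

theorem add_mul_mmSlope_mem_Icc {a b : ℝ} (hu : ∀ j, u j ∈ Icc a b) (j : ℤ) {t : ℝ}
    (ht : |t| ≤ 1) : u j + t * mmSlope u j ∈ Icc a b := by
  have hscale {s d : ℝ} (hs : s ∈ uIcc 0 d) : |t| * s ∈ uIcc 0 d :=
    (convex_uIcc 0 d).smul_mem_of_zero_mem left_mem_uIcc hs ⟨abs_nonneg t, ht⟩
  have hright := hscale (mmSlope_mem_uIcc_right u j)
  have hleft := hscale (mmSlope_mem_uIcc_left u j)
  obtain ⟨hj, hj'⟩ := hu j
  obtain ⟨hl, hl'⟩ := hu (j - 1)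
  obtain ⟨hr, hr'⟩ := hu (j + 1)
  rcases abs_cases t with ⟨h, -⟩ | ⟨h, -⟩ <;> rw [h] at hright hleft
  · rcases mem_uIcc.1 hright with hσ | hσ <;> constructor <;> linarith [hσ.1, hσ.2]
  · rcases mem_uIcc.1 hleft with hσ | hσ <;> constructor <;> linarith [hσ.1, hσ.2]

theorem mmSlope_eq_min_upJump (h : 0 < upJump u (j - 1) ∨ 0 < upJump u j) :
    mmSlope u j = min (upJump u (j - 1)) (upJump u j) := by
  have hright := mmSlope_mem_uIcc_right u j
  have hleft := mmSlope_mem_uIcc_left u j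
  rw [upJump_sub_one, rise, upJump, posPart_pos_iff, posPart_pos_iff] at h
  rw [upJump_sub_one, rise, upJump]
  rcases le_or_gt (u j - u (j - 1)) 0 with hl | hl
  · have hr := h.resolve_left hl.not_gt
    rw [uIcc_of_ge hl] at hleft
    rw [uIcc_of_le hr.le] at hright
    rw [posPart_eq_zero.2 hl, min_eq_left (posPart_nonneg _)]
    exact le_antisymm hleft.2 hright.1
  rcases le_or_gt (u (j + 1) - u j) 0 with hr | hr
  · rw [uIcc_of_ge hr] at hright
    rw [uIcc_of_le hl.le] at hleft
    rw [posPart_eq_zero.2 hr, min_eq_right (posPart_nonneg _)]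
    exact le_antisymm hright.2 hleft.1
  rw [posPart_eq_self.2 hl.le, posPart_eq_self.2 hr.le, mmSlope,
    minmod_of_pos hr (by linarith) hl]
  rcases le_total (u j - u (j - 1)) (u (j + 1) - u j) with hle | hle
  · rw [min_eq_left hle, min_eq_right (b := u j - u (j - 1)) (by linarith), min_eq_right hle]
  · rw [min_eq_right hle, min_eq_left (le_min (by linarith) hle)]

theorem recon_eq_min (p : ℤ → ℝ) (j : ℤ) :
    recon p j = 1 / 8 * (min (p j) (p (j + 1)) - min (p (j - 1)) (p j)) := by
  rw [recon, rise, fall, add_sub_cancel_right, posPart_def, negPart_def]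
  rcases le_total (p (j - 1)) (p j) with h₁ | h₁ <;>
    rcases le_total (p j) (p (j + 1)) with h₂ | h₂ <;>
    simp only [h₁, h₂, min_eq_left, min_eq_right, max_eq_left, max_eq_right, sub_nonneg, neg_sub,
      sub_nonpos] <;> ring

theorem recon_upJump (h : 0 < upJump u j) :
    recon (upJump u) j = 1 / 8 * (mmSlope u (j + 1) - mmSlope u j) := by
  rw [recon_eq_min, mmSlope_eq_min_upJump (.inr h),
    mmSlope_eq_min_upJump (.inl (by rwa [add_sub_cancel_right])), add_sub_cancel_right]

theorem recon_eq_zero_of_eq_zero {p : ℤ → ℝ} (hp : ∀ j, 0 ≤ p j) (h : p j = 0) :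
    recon p j = 0 := by
  rw [recon_eq_min, h, min_eq_left (hp _), min_eq_right (hp _), sub_zero, mul_zero]

end Slope

/-! ### The scheme -/

/-- The data of one step of the scheme, with the factor `lam = Δt / Δx` absorbed into the flux: `kd`
is the discrete coefficient, `u` the sequence of cell averages and `κ` the Courant number. -/
structure NormalizedStep (K : Set ℝ) (ulo uhi g Λ κ L M : ℝ) (f : ℝ → ℝ → ℝ) (kd u : ℤ → ℝ) :
    Prop where
  flux : IsLipschitzConvexFlux K ulo uhi g Λ κ L M f
  kd_mem : ∀ j, kd j ∈ K
  u_mem : ∀ j, u j ∈ Icc ulo uhi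
  kappa_le : κ ≤ 1 / 4000
  kappa_mul_le : κ * Λ ≤ g / 7500

/-- The wave speed in the cell `j`. -/
noncomputable def cellSpeed (U : Set ℝ) (f : ℝ → ℝ → ℝ) (kd u : ℤ → ℝ) (j : ℤ) : ℝ :=
  partialU U f (kd j) (u j)

/-- The mean wave speed over the jump between the cells `j` and `j + 1`, for the coefficient of the
left cell. -/
noncomputable def meanSpeed (f : ℝ → ℝ → ℝ) (kd u : ℤ → ℝ) (j : ℤ) : ℝ :=
  slope (f (kd j)) (u j) (u (j + 1))

/-- The jump of the mid-time flux between the cells `j` and `j + 1`, for the coefficient of the left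
cell. -/
noncomputable def midJump (U : Set ℝ) (f : ℝ → ℝ → ℝ) (kd u : ℤ → ℝ) (j : ℤ) : ℝ :=
  f (kd j) (midValue 1 U f kd u (j + 1)) - f (kd j) (midValue 1 U f kd u j)

/-- The jump of the mid-time flux where `u` increases, and zero where it does not. -/
noncomputable def upMidJump (U : Set ℝ) (f : ℝ → ℝ → ℝ) (kd u : ℤ → ℝ) (j : ℤ) : ℝ :=
  if 0 < upJump u j then midJump U f kd u j else 0

/-- The effect on a quantity with Lipschitz constant `M` of the jump of the discrete coefficient
between the cells `j` and `j + 1`. -/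
noncomputable def coeffJump (M : ℝ) (kd : ℤ → ℝ) (j : ℤ) : ℝ := M * |kd (j + 1) - kd j|

namespace NormalizedStep

variable {K : Set ℝ} {ulo uhi g Λ κ L M : ℝ} {f : ℝ → ℝ → ℝ} {kd u : ℤ → ℝ} {j : ℤ}

local notation "U" => Icc ulo uhi

theorem abs_cellSpeed_le (h : NormalizedStep K ulo uhi g Λ κ L M f kd u) (j : ℤ) :
    |cellSpeed U f kd u j| ≤ κ :=
  h.flux.abs_partialU_le _ (h.kd_mem j) _ (h.u_mem j)

theorem kappa_nonneg (h : NormalizedStep K ulo uhi g Λ κ L M f kd u) : 0 ≤ κ :=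
  (abs_nonneg _).trans (h.abs_cellSpeed_le 0)

theorem coeffJump_flux_nonneg (h : NormalizedStep K ulo uhi g Λ κ L M f kd u) (j : ℤ) :
    0 ≤ coeffJump L kd j :=
  (abs_nonneg _).trans (h.flux.flux_lipschitz _ (h.kd_mem j) _ (h.kd_mem (j + 1)) _ (h.u_mem j))

theorem coeffJump_speed_nonneg (h : NormalizedStep K ulo uhi g Λ κ L M f kd u) (j : ℤ) :
    0 ≤ coeffJump M kd j :=
  (abs_nonneg _).trans (h.flux.speed_lipschitz _ (h.kd_mem j) _ (h.kd_mem (j + 1)) _ (h.u_mem j))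

theorem abs_midValue_sub_le (h : NormalizedStep K ulo uhi g Λ κ L M f kd u) (j : ℤ) :
    |midValue 1 U f kd u j - u j| ≤ κ / 2 * |mmSlope u j| := by
  rw [midValue, sub_sub_cancel_left, abs_neg, abs_mul, abs_mul, abs_of_pos one_half_pos]
  have := h.abs_cellSpeed_le j
  rw [cellSpeed] at this
  gcongr
  linarith

theorem midValue_mem (h : NormalizedStep K ulo uhi g Λ κ L M f kd u) (j : ℤ) :
    midValue 1 U f kd u j ∈ U := by
  rw [midValue, sub_eq_add_neg, ← neg_mul]
  refine add_mul_mmSlope_mem_Icc h.u_mem j ?_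
  rw [abs_neg, abs_mul, abs_of_pos one_half_pos]
  linarith [show |partialU U f (kd j) (u j)| ≤ κ from h.abs_cellSpeed_le j, h.kappa_le]

theorem abs_midJump_le (h : NormalizedStep K ulo uhi g Λ κ L M f kd u) (j : ℤ) :
    |midJump U f kd u j| ≤ 2 * κ * |u (j + 1) - u j| := by
  have hκ := h.kappa_nonneg
  have hσ := abs_mmSlope_le_right u j
  have hσ' := abs_mmSlope_le_left u (j + 1)
  rw [add_sub_cancel_right] at hσ'
  have hmid : |midValue 1 U f kd u (j + 1) - midValue 1 U f kd u j| ≤ 2 * |u (j + 1) - u j| := by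
    have hκσ : κ / 2 * |mmSlope u j| ≤ 1 / 2 * |u (j + 1) - u j| := by
      gcongr; linarith [h.kappa_le]
    have hκσ' : κ / 2 * |mmSlope u (j + 1)| ≤ 1 / 2 * |u (j + 1) - u j| := by
      gcongr; linarith [h.kappa_le]
    have hj := (h.abs_midValue_sub_le j).trans hκσ
    have hj' := (h.abs_midValue_sub_le (j + 1)).trans hκσ'
    have htriangle := abs_add_three (midValue 1 U f kd u (j + 1) - u (j + 1))
      (u (j + 1) - u j) (u j - midValue 1 U f kd u j)
    rw [sub_add_sub_cancel, sub_add_sub_cancel, abs_sub_comm (u j)] at htriangle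
    linarith
  calc _ ≤ κ * |midValue 1 U f kd u (j + 1) - midValue 1 U f kd u j| :=
        h.flux.abs_sub_le_mul (h.kd_mem j) (h.midValue_mem j) (h.midValue_mem (j + 1))
    _ ≤ κ * (2 * |u (j + 1) - u j|) := by gcongr
    _ = 2 * κ * |u (j + 1) - u j| := by ring

theorem abs_meanSpeed_sub_left_le (h : NormalizedStep K ulo uhi g Λ κ L M f kd u)
    (hj : 0 < upJump u j) :
    |meanSpeed f kd u j - cellSpeed U f kd u j|
      ≤ speedGap κ Λ (upJump u) (coeffJump M kd) j := by
  have hlt : u j < u (j + 1) := sub_pos.1 (posPart_pos_iff.1 hj)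
  refine (h.flux.abs_slope_sub_partialU_le (h.kd_mem j) (h.kd_mem j) (h.u_mem j)
    (h.u_mem (j + 1)) hlt (left_mem_Icc.2 hlt.le)).trans ?_
  rw [sub_self, abs_zero, mul_zero, ← upJump_eq_sub hj]
  exact min_le_min_left _ (add_le_add_right (h.coeffJump_speed_nonneg j) _)

theorem abs_meanSpeed_sub_right_le (h : NormalizedStep K ulo uhi g Λ κ L M f kd u)
    (hj : 0 < upJump u j) :
    |meanSpeed f kd u j - cellSpeed U f kd u (j + 1)|
      ≤ speedGap κ Λ (upJump u) (coeffJump M kd) j := by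
  have hlt : u j < u (j + 1) := sub_pos.1 (posPart_pos_iff.1 hj)
  have hgap := h.flux.abs_slope_sub_partialU_le (h.kd_mem j) (h.kd_mem (j + 1)) (h.u_mem j)
    (h.u_mem (j + 1)) hlt (right_mem_Icc.2 hlt.le)
  rwa [← upJump_eq_sub hj] at hgap

theorem abs_cellSpeed_sub_le (h : NormalizedStep K ulo uhi g Λ κ L M f kd u)
    (hj : 0 < upJump u j) :
    |cellSpeed U f kd u (j + 1) - cellSpeed U f kd u j|
      ≤ speedGap κ Λ (upJump u) (coeffJump M kd) j := by
  have hgap := h.flux.abs_partialU_sub_le_min (h.kd_mem j) (h.kd_mem (j + 1)) (h.u_mem j)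
    (h.u_mem (j + 1))
  rwa [← upJump_eq_sub hj, abs_of_pos hj] at hgap

theorem abs_partialU_sub_cellSpeed_le (h : NormalizedStep K ulo uhi g Λ κ L M f kd u)
    (hj : 0 < upJump u j) :
    |partialU U f (kd j) (u (j + 1)) - cellSpeed U f kd u j|
      ≤ speedGap κ Λ (upJump u) (coeffJump M kd) j := by
  have hgap := h.flux.abs_partialU_sub_le_min (h.kd_mem j) (h.kd_mem j) (h.u_mem j)
    (h.u_mem (j + 1))
  rw [sub_self, abs_zero, mul_zero, ← upJump_eq_sub hj, abs_of_pos hj] at hgap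
  exact hgap.trans (min_le_min_left _ (add_le_add_right (h.coeffJump_speed_nonneg j) _))

theorem neg_coeffJump_le_cellSpeed_sub (h : NormalizedStep K ulo uhi g Λ κ L M f kd u)
    (hj : 0 < upJump u j) :
    -coeffJump M kd j ≤ cellSpeed U f kd u (j + 1) - cellSpeed U f kd u j := by
  have hle : u j ≤ u (j + 1) := (sub_pos.1 (posPart_pos_iff.1 hj)).le
  have hg := mul_nonneg h.flux.gamma₁_nonneg (sub_nonneg.2 hle)
  have hmono := h.flux.mul_le_partialU_sub _ (h.kd_mem j) _ (h.u_mem j) _ (h.u_mem (j + 1)) hle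
  have hcoeff := (abs_le.1 (h.flux.speed_lipschitz _ (h.kd_mem j) _ (h.kd_mem (j + 1)) _
    (h.u_mem (j + 1)))).1
  unfold coeffJump cellSpeed
  linarith

theorem mul_upJump_add_sub_coeffJump_le (h : NormalizedStep K ulo uhi g Λ κ L M f kd u)
    (hj : 0 < upJump u j) (hj' : 0 < upJump u (j + 1)) :
    g / 2 * (upJump u j + upJump u (j + 1)) - coeffJump M kd j
      ≤ meanSpeed f kd u (j + 1) - meanSpeed f kd u j := by
  have hleft := (h.flux.slope_mem_Icc (h.kd_mem j) (h.u_mem j) (h.u_mem (j + 1))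
    (sub_pos.1 (posPart_pos_iff.1 hj))).2
  have hright := (h.flux.slope_mem_Icc (h.kd_mem (j + 1)) (h.u_mem (j + 1)) (h.u_mem (j + 1 + 1))
    (sub_pos.1 (posPart_pos_iff.1 hj'))).1
  have hcoeff := (abs_le.1 (h.flux.speed_lipschitz _ (h.kd_mem j) _ (h.kd_mem (j + 1)) _
    (h.u_mem (j + 1)))).1
  rw [upJump_eq_sub hj, upJump_eq_sub hj', coeffJump, meanSpeed, meanSpeed]
  linarith

theorem mul_upJump_le (h : NormalizedStep K ulo uhi g Λ κ L M f kd u) (j : ℤ) :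
    g * upJump u j ≤ 1 / 6 := by
  rcases (upJump_nonneg u j).eq_or_lt with hj | hj
  · rw [← hj, mul_zero]; norm_num
  have hmono := h.flux.mul_le_partialU_sub _ (h.kd_mem j) _ (h.u_mem j) _ (h.u_mem (j + 1))
    (sub_pos.1 (posPart_pos_iff.1 hj)).le
  have hleft := (abs_le.1 (h.flux.abs_partialU_le _ (h.kd_mem j) _ (h.u_mem j))).1
  have hright := (abs_le.1 (h.flux.abs_partialU_le _ (h.kd_mem j) _ (h.u_mem (j + 1)))).2
  rw [upJump_eq_sub hj]
  linarith [h.kappa_le]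

theorem abs_flux_midValue_sub_le (h : NormalizedStep K ulo uhi g Λ κ L M f kd u)
    (hj : 0 < upJump u j) {i : ℤ} (hσ : |mmSlope u i| ≤ upJump u j) :
    |f (kd j) (midValue 1 U f kd u i) - f (kd j) (u i)
        - partialU U f (kd j) (u i) * (midValue 1 U f kd u i - u i)|
      ≤ κ / 2 * speedGap κ Λ (upJump u) (coeffJump M kd) j * upJump u j := by
  have hκ := h.kappa_nonneg
  have hΛ := h.flux.gamma₂_nonneg
  have hmid := (h.abs_midValue_sub_le i).trans (mul_le_mul_of_nonneg_left hσ (by positivity))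
  have hmid' : |midValue 1 U f kd u i - u i| ≤ upJump u j :=
    hmid.trans (mul_le_of_le_one_left hj.le (by linarith [h.kappa_le]))
  have hτ : 0 ≤ min (2 * κ) (Λ * upJump u j + coeffJump M kd j) :=
    (abs_nonneg _).trans (h.abs_cellSpeed_sub_le hj)
  calc _ ≤ min (2 * κ) (Λ * |midValue 1 U f kd u i - u i|) * |midValue 1 U f kd u i - u i| :=
        h.flux.abs_sub_sub_partialU_mul_le (h.kd_mem j) (h.u_mem i) (h.midValue_mem i)
    _ ≤ min (2 * κ) (Λ * upJump u j + coeffJump M kd j) * (κ / 2 * upJump u j) := by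
      gcongr
      exact (mul_le_mul_of_nonneg_left hmid' hΛ).trans
        (le_add_of_nonneg_right (h.coeffJump_speed_nonneg j))
    _ = κ / 2 * speedGap κ Λ (upJump u) (coeffJump M kd) j * upJump u j := by
      rw [speedGap]; ring

theorem abs_midJump_sub_le (h : NormalizedStep K ulo uhi g Λ κ L M f kd u)
    (hj : 0 < upJump u j) :
    |midJump U f kd u j
        - (meanSpeed f kd u j * upJump u j - 4 * cellSpeed U f kd u j ^ 2 * recon (upJump u) j)|
      ≤ 2 * κ * speedGap κ Λ (upJump u) (coeffJump M kd) j * upJump u j := by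
  have hκ := h.kappa_nonneg
  have hP := upJump_eq_sub hj
  have hσ : |mmSlope u j| ≤ upJump u j := by
    rw [← abs_of_pos hj, hP]; exact abs_mmSlope_le_right u j
  have hσ' : |mmSlope u (j + 1)| ≤ upJump u j := by
    rw [← abs_of_pos hj, hP]; simpa only [add_sub_cancel_right] using abs_mmSlope_le_left u (j + 1)
  have hexp := h.abs_flux_midValue_sub_le hj hσ
  have hexp' := h.abs_flux_midValue_sub_le hj hσ'
  have hc := h.abs_cellSpeed_le j
  have hc' := h.abs_cellSpeed_le (j + 1)
  have hgap := h.abs_partialU_sub_cellSpeed_le hj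
  have hgap' := h.abs_cellSpeed_sub_le hj
  have hmean : meanSpeed f kd u j * upJump u j = f (kd j) (u (j + 1)) - f (kd j) (u j) := by
    rw [meanSpeed, slope_def_field, ← hP, div_mul_cancel₀ _ hj.ne']
  have hmid (i : ℤ) :
      midValue 1 U f kd u i - u i = -(1 / 2 * cellSpeed U f kd u i * mmSlope u i) :=
    sub_sub_cancel_left _ _
  rw [hmid] at hexp hexp'
  rw [hmean, recon_upJump hj, midJump]
  change |_ - _ - cellSpeed U f kd u j * _| ≤ _ at hexp
  set τ := speedGap κ Λ (upJump u) (coeffJump M kd) j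
  set c := cellSpeed U f kd u j
  set c₁ := cellSpeed U f kd u (j + 1)
  set c' := partialU U f (kd j) (u (j + 1))
  have hτ : 0 ≤ τ := (abs_nonneg _).trans hgap
  have hfirst : |c₁ * (c' - c) * mmSlope u (j + 1)| ≤ κ * τ * upJump u j := by
    rw [abs_mul, abs_mul]; gcongr
  have hsecond : |c * (c₁ - c) * mmSlope u (j + 1)| ≤ κ * τ * upJump u j := by
    rw [abs_mul, abs_mul]; gcongr
  rw [abs_le] at hexp hexp' hfirst hsecond ⊢
  constructor <;> linarith [hexp.1, hexp.2, hexp'.1, hexp'.2, hfirst.1, hfirst.2, hsecond.1,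
    hsecond.2]

theorem abs_upMidJump_sub_le (h : NormalizedStep K ulo uhi g Λ κ L M f kd u) (j : ℤ) :
    |upMidJump U f kd u j
        - (meanSpeed f kd u j * upJump u j - 4 * cellSpeed U f kd u j ^ 2 * recon (upJump u) j)|
      ≤ 2 * κ * speedGap κ Λ (upJump u) (coeffJump M kd) j * upJump u j := by
  rw [upMidJump]
  split_ifs with hj
  · exact h.abs_midJump_sub_le hj
  · have hzero : upJump u j = 0 := le_antisymm (not_lt.1 hj) (upJump_nonneg u j)
    rw [recon_eq_zero_of_eq_zero (upJump_nonneg u) hzero, hzero]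
    simp only [mul_zero, sub_zero, abs_zero, le_refl]

theorem convexStep (h : NormalizedStep K ulo uhi g Λ κ L M f kd u)
    (hkd : Summable fun j => |kd (j + 1) - kd j|) (hs : SqSummable (upJump u)) :
    ConvexStep (upJump u) (cellSpeed U f kd u) (meanSpeed f kd u) (upMidJump U f kd u)
      (coeffJump M kd) κ g Λ (uhi - ulo) where
  p_nonneg := upJump_nonneg u
  p_le := upJump_le h.u_mem
  sqSummable_p := hs
  kappa_le := h.kappa_le
  g_nonneg := h.flux.gamma₁_nonneg
  Lambda_nonneg := h.flux.gamma₂_nonneg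
  kappa_mul_le := h.kappa_mul_le
  g_mul_le := h.mul_upJump_le
  abs_c_le := h.abs_cellSpeed_le
  abs_v_le j := h.flux.abs_slope_le (h.kd_mem j) (h.u_mem j) (h.u_mem (j + 1))
  mu_nonneg := h.coeffJump_speed_nonneg
  summable_mu := hkd.mul_left M
  v_sub_left _ hj := h.abs_meanSpeed_sub_left_le hj
  v_sub_right _ hj := h.abs_meanSpeed_sub_right_le hj
  c_sub _ hj := h.abs_cellSpeed_sub_le hj
  c_mono _ hj := h.neg_coeffJump_le_cellSpeed_sub hj
  v_mono _ hj hj' := h.mul_upJump_add_sub_coeffJump_le hj hj'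
  phi_sub := h.abs_upMidJump_sub_le

theorem abs_schemeStep_sub_le (h : NormalizedStep K ulo uhi g Λ κ L M f kd u) (j : ℤ) :
    |schemeStep 1 U f kd u j - 1 / 2 * (u j + u (j + 1))
        + (recon (upJump u) j + upMidJump U f kd u j)|
      ≤ 1 / 2 * (upJump u j - (u (j + 1) - u j)) + coeffJump L kd j := by
  have hcoeff := h.flux.flux_lipschitz _ (h.kd_mem j) _ (h.kd_mem (j + 1)) _
    (h.midValue_mem (j + 1))
  have hstep : schemeStep 1 U f kd u j - 1 / 2 * (u j + u (j + 1))
      = -(1 / 8 * (mmSlope u (j + 1) - mmSlope u j)) - midJump U f kd u j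
        - (f (kd (j + 1)) (midValue 1 U f kd u (j + 1))
          - f (kd j) (midValue 1 U f kd u (j + 1))) := by
    rw [schemeStep, midJump]; ring
  rw [hstep, upMidJump, coeffJump]
  split_ifs with hj
  · rw [recon_upJump hj, upJump_eq_sub hj]
    rw [abs_le] at hcoeff ⊢
    constructor <;> linarith [hcoeff.1, hcoeff.2]
  · have hzero : upJump u j = 0 := le_antisymm (not_lt.1 hj) (upJump_nonneg u j)
    have hle : u (j + 1) - u j ≤ 0 := posPart_eq_zero.1 hzero
    have hmid := h.abs_midJump_le j
    have hκ : 2 * κ * |u (j + 1) - u j| ≤ 1 / 4 * |u (j + 1) - u j| := by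
      gcongr; linarith [h.kappa_le]
    have hσ := abs_mmSlope_le_right u j
    have hσ' := abs_mmSlope_le_left u (j + 1)
    rw [add_sub_cancel_right] at hσ'
    rw [recon_eq_zero_of_eq_zero (upJump_nonneg u) hzero, hzero]
    rw [abs_of_nonpos hle] at hmid hκ hσ hσ'
    rw [abs_le] at hmid hcoeff hσ hσ' ⊢
    constructor <;> linarith [hmid.1, hmid.2, hcoeff.1, hcoeff.2, hσ.1, hσ.2, hσ'.1, hσ'.2]

theorem sq_rise_schemeStep_le (h : NormalizedStep K ulo uhi g Λ κ L M f kd u)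
    {B : ℝ} (hB : ∀ j, coeffJump L kd j ≤ B) (hφ : ∀ j, |upMidJump U f kd u j| ≤ 1 / 8 * upJump u j)
    (j : ℤ) :
    rise (schemeStep 1 U f kd u) j ^ 2
      ≤ (1 / 2 * (upJump u (j - 1) + upJump u j)
          - (recon (upJump u) j + upMidJump U f kd u j
            - (recon (upJump u) (j - 1) + upMidJump U f kd u (j - 1)))) ^ 2
        + (2 * (uhi - ulo) + 2 * B) * (coeffJump L kd j + coeffJump L kd (j - 1)) := by
  have hW := upJump_add_le h.u_mem j
  have hright := h.abs_schemeStep_sub_le j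
  have hleft := h.abs_schemeStep_sub_le (j - 1)
  have hrecon := abs_recon_le (upJump_nonneg u) j
  have hrecon' := abs_recon_le (upJump_nonneg u) (j - 1)
  have hφj := hφ j
  have hφj' := hφ (j - 1)
  rw [sub_add_cancel] at hleft
  rw [abs_le] at hright hleft hrecon hrecon' hφj hφj'
  have hδ := add_nonneg (h.coeffJump_flux_nonneg j) (h.coeffJump_flux_nonneg (j - 1))
  have hδB := add_le_add (hB j) (hB (j - 1))
  have := add_nonneg (upJump_nonneg u (j - 1)) (upJump_nonneg u j)
  set Y := 1 / 2 * (upJump u (j - 1) + upJump u j)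
    - (recon (upJump u) j + upMidJump U f kd u j
      - (recon (upJump u) (j - 1) + upMidJump U f kd u (j - 1))) with hY
  set δ := coeffJump L kd j + coeffJump L kd (j - 1)
  have hY₀ : 0 ≤ Y := by linarith
  have hYW : Y ≤ uhi - ulo := by linarith
  have hrise : rise (schemeStep 1 U f kd u) j ≤ Y + δ :=
    max_le (by linarith [hright.2, hleft.1]) (add_nonneg hY₀ hδ)
  calc rise (schemeStep 1 U f kd u) j ^ 2 ≤ (Y + δ) ^ 2 :=
        pow_le_pow_left₀ (posPart_nonneg _) hrise 2
    _ = Y ^ 2 + (2 * Y + δ) * δ := by ring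
    _ ≤ Y ^ 2 + (2 * (uhi - ulo) + 2 * B) * δ := by gcongr; linarith

theorem telescopeLE_sq_rise_schemeStep (h : NormalizedStep K ulo uhi g Λ κ L M f kd u)
    (hkd : Summable fun j => |kd (j + 1) - kd j|) (hs : SqSummable (upJump u))
    {B : ℝ} (hB : ∀ j, coeffJump L kd j ≤ B) :
    TelescopeLE (fun j => rise (schemeStep 1 U f kd u) j ^ 2)
      (fun j => upJump u j ^ 2 - 1 / 500 * g * upJump u j ^ 3
        + (2 * (uhi - ulo) ^ 2 * M + (4 * (uhi - ulo) + 4 * B) * L) * |kd (j + 1) - kd j|) := by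
  have hstep := h.convexStep hkd hs
  have hneighbor : TelescopeLE
      (fun j => (2 * (uhi - ulo) + 2 * B) * (coeffJump L kd j + coeffJump L kd (j - 1)))
      (fun j => (4 * (uhi - ulo) + 4 * B) * coeffJump L kd j) := by
    refine ⟨fun j => (2 * (uhi - ulo) + 2 * B) * coeffJump L kd (j - 1),
      (summable_int_shift (hkd.mul_left L) (-1)).mul_left _, fun j => ?_⟩
    simp only [add_sub_cancel_right]
    linarith
  refine (TelescopeLE.of_le (h.sq_rise_schemeStep_le hB hstep.abs_phi_le)).trans
    ((hstep.telescopeLE_sq.add hneighbor).trans (.of_le fun j => ?_))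
  simp only [coeffJump]
  linarith

end NormalizedStep

/-! ### The discrete coefficient -/

theorem tsum_edist_le_eVariationOn {α E : Type*} [LinearOrder α] [PseudoEMetricSpace E]
    (f : α → E) {x : ℤ → α} (hx : Monotone x) :
    ∑' j, edist (f (x (j + 1))) (f (x j)) ≤ eVariationOn f univ := by
  rw [ENNReal.tsum_eq_iSup_sum' (fun n : ℕ => Finset.Ico (-n : ℤ) n)]
  · refine iSup_le fun n => ?_
    have hIco : Finset.Ico (-n : ℤ) n
        = (Finset.range (2 * n)).image fun i : ℕ => (i : ℤ) - n := by
      ext j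
      simp only [Finset.mem_Ico, Finset.mem_image, Finset.mem_range]
      exact ⟨fun hj => ⟨(j + n).toNat, by lia, by lia⟩, by rintro ⟨i, hi, rfl⟩; lia⟩
    have hmono : Monotone fun i : ℕ => x (i - n) := fun a b hab => hx (by lia)
    have hvar := eVariationOn.sum_le (f := f) (n := 2 * n) hmono fun _ => mem_univ _
    simp only [Nat.cast_add, Nat.cast_one, add_sub_right_comm] at hvar
    rwa [hIco, Finset.sum_image fun a _ b _ hab => by lia]
  · intro s
    obtain ⟨n, hn⟩ := (s.image Int.natAbs).bddAbove
    refine ⟨n + 1, fun j hj => Finset.mem_Ico.2 ?_⟩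
    have : j.natAbs ≤ n := hn (Finset.mem_coe.2 (Finset.mem_image_of_mem _ hj))
    constructor <;> lia

section CellAverage

variable {k g : ℝ → ℝ} {dx x₀ : ℝ}

theorem cellAverage_congr (h : g =ᵐ[volume] k) : cellAverage dx x₀ g = cellAverage dx x₀ k := by
  ext j
  rw [cellAverage, cellAverage, intervalIntegral.integral_congr_ae (h.mono fun x hx _ => hx)]

theorem cellAverage_mem (hk : LocallyIntegrable k) {s : Set ℝ} (hs : Convex ℝ s)
    (hsc : IsClosed s) (hks : ∀ᵐ x, k x ∈ s) (hdx : 0 < dx) (j : ℤ) :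
    cellAverage dx x₀ k j ∈ s := by
  have hlt : x₀ + ((j : ℝ) - 1 / 2) * dx < x₀ + ((j : ℝ) + 1 / 2) * dx := by linarith
  have haverage : cellAverage dx x₀ k j
      = ⨍ x in (x₀ + ((j : ℝ) - 1 / 2) * dx)..(x₀ + ((j : ℝ) + 1 / 2) * dx), k x := by
    rw [cellAverage, interval_average_eq, smul_eq_mul, one_div]
    congr 2
    ring
  rw [haverage, uIoc_of_le hlt.le]
  refine hs.set_average_mem hsc ?_ measure_Ioc_lt_top.ne (ae_restrict_of_ae hks)
    ((hk.integrableOn_isCompact isCompact_Icc).mono_set Ioc_subset_Icc_self)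
  rw [Real.volume_Ioc]
  simpa only [ne_eq, ENNReal.ofReal_eq_zero, not_le, sub_pos] using hlt

theorem abs_cellAverage_le_supNorm (hk : MemLp k ∞ volume) (hdx : 0 < dx) (j : ℤ) :
    |cellAverage dx x₀ k j| ≤ supNorm k := by
  refine abs_le.2 (cellAverage_mem (hk.locallyIntegrable le_top) (convex_Icc _ _) isClosed_Icc ?_
    hdx j)
  rw [supNorm, toReal_eLpNorm hk.aestronglyMeasurable]
  exact (ae_le_lpNorm_exponent_top hk).mono fun x => abs_le.1

theorem cellAverage_eq_integral_translate (k : ℝ → ℝ) (dx x₀ : ℝ) (j : ℤ) :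
    cellAverage dx x₀ k j = 1 / dx * ∫ y in (x₀ - dx / 2)..(x₀ + dx / 2), k (y + j * dx) := by
  rw [cellAverage, intervalIntegral.integral_comp_add_right]
  congr 2 <;> ring

theorem edist_cellAverage_le (hk : LocallyIntegrable k) (hdx : 0 < dx) (j : ℤ) :
    edist (cellAverage dx x₀ k (j + 1)) (cellAverage dx x₀ k j)
      ≤ ENNReal.ofReal (1 / dx) * ∫⁻ y in Ioc (x₀ - dx / 2) (x₀ + dx / 2),
          edist (k (y + ((j + 1 : ℤ) : ℝ) * dx)) (k (y + (j : ℝ) * dx)) := by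
  have hint (i : ℤ) : IntervalIntegrable (fun y => k (y + i * dx)) volume
      (x₀ - dx / 2) (x₀ + dx / 2) := by
    have := (hk.integrableOn_isCompact isCompact_uIcc).intervalIntegrable.comp_add_right
      (a := x₀ - dx / 2 + i * dx) (b := x₀ + dx / 2 + i * dx) (i * dx)
    rwa [add_sub_cancel_right, add_sub_cancel_right] at this
  simp only [edist_eq_enorm_sub]
  rw [cellAverage_eq_integral_translate, cellAverage_eq_integral_translate, ← mul_sub,
    ← intervalIntegral.integral_sub (hint _) (hint _), enorm_mul,
    Real.enorm_of_nonneg (by positivity), intervalIntegral.integral_of_le (by linarith)]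
  gcongr
  exact enorm_integral_le_lintegral_enorm _

theorem tsum_edist_cellAverage_le (hk : LocallyIntegrable k) (hdx : 0 < dx) :
    ∑' j, edist (cellAverage dx x₀ k (j + 1)) (cellAverage dx x₀ k j) ≤ eVariationOn k univ := by
  have hmeas (i : ℤ) : AEMeasurable (fun y => k (y + i * dx))
      (volume.restrict (Ioc (x₀ - dx / 2) (x₀ + dx / 2))) :=
    (hk.aestronglyMeasurable.comp_measurePreserving
      (measurePreserving_add_right volume (i * dx))).aemeasurable.restrict
  have hmono (y : ℝ) : Monotone fun j : ℤ => y + j * dx := fun a b hab => by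
    have : (a : ℝ) ≤ b := mod_cast hab
    dsimp only
    gcongr
  calc ∑' j, edist (cellAverage dx x₀ k (j + 1)) (cellAverage dx x₀ k j)
      ≤ ∑' j : ℤ, ENNReal.ofReal (1 / dx) * ∫⁻ y in Ioc (x₀ - dx / 2) (x₀ + dx / 2),
          edist (k (y + ((j + 1 : ℤ) : ℝ) * dx)) (k (y + (j : ℝ) * dx)) :=
        ENNReal.tsum_le_tsum fun j => edist_cellAverage_le hk hdx j
    _ = ENNReal.ofReal (1 / dx) * ∫⁻ y in Ioc (x₀ - dx / 2) (x₀ + dx / 2),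
          ∑' j : ℤ, edist (k (y + ((j + 1 : ℤ) : ℝ) * dx)) (k (y + (j : ℝ) * dx)) := by
      rw [ENNReal.tsum_mul_left, lintegral_tsum fun j => (hmeas (j + 1)).edist (hmeas j)]
    _ ≤ ENNReal.ofReal (1 / dx) * ∫⁻ _ in Ioc (x₀ - dx / 2) (x₀ + dx / 2),
          eVariationOn k univ := by
      gcongr with y
      exact tsum_edist_le_eVariationOn k (hmono y)
    _ = eVariationOn k univ := by
      rw [setLIntegral_const, Real.volume_Ioc, mul_left_comm, ← ENNReal.ofReal_mul (by positivity),
        show 1 / dx * (x₀ + dx / 2 - (x₀ - dx / 2)) = 1 by field_simp; ring, ENNReal.ofReal_one,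
        mul_one]

theorem tsum_edist_cellAverage_le_totalVar (hk : LocallyIntegrable k) (hdx : 0 < dx) :
    ∑' j, edist (cellAverage dx x₀ k (j + 1)) (cellAverage dx x₀ k j) ≤ totalVar k :=
  le_iInf₂ fun g hg => by
    rw [← cellAverage_congr hg]
    exact tsum_edist_cellAverage_le (hk.congr hg.symm) hdx

theorem summable_abs_cellAverage_sub (hk : LocallyIntegrable k) (hvar : totalVar k ≠ ∞)
    (hdx : 0 < dx) :
    Summable fun j => |cellAverage dx x₀ k (j + 1) - cellAverage dx x₀ k j| := by
  have hfin := ne_top_of_le_ne_top hvar (tsum_edist_cellAverage_le_totalVar (x₀ := x₀) hk hdx)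
  refine (ENNReal.summable_toReal hfin).congr fun j => ?_
  rw [edist_dist, ENNReal.toReal_ofReal dist_nonneg, Real.dist_eq]

theorem tsum_abs_cellAverage_sub_le_bvNorm (hk : LocallyIntegrable k) (hvar : totalVar k ≠ ∞)
    (hdx : 0 < dx) :
    ∑' j, |cellAverage dx x₀ k (j + 1) - cellAverage dx x₀ k j| ≤ bvNorm k := by
  have hle := ENNReal.toReal_mono hvar (tsum_edist_cellAverage_le_totalVar (x₀ := x₀) hk hdx)
  rw [ENNReal.tsum_toReal_eq fun _ => edist_ne_top _ _] at hle
  simpa only [edist_dist, Real.dist_eq, ENNReal.toReal_ofReal (abs_nonneg _), bvNorm] using hle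

end CellAverage

/-! ### Fluxes affine in the coefficient -/

theorem derivWithin_Icc_self (g : ℝ → ℝ) (a x : ℝ) : derivWithin g (Icc a a) x = 0 :=
  derivWithin_zero_of_not_accPt fun h => Set.Infinite.of_accPt h (by simp)

theorem abs_le_rectNorm {K U : Set ℝ} {g : ℝ → ℝ → ℝ} {B k u : ℝ}
    (hB : ∀ k ∈ K, ∀ u ∈ U, |g k u| ≤ B) (hk : k ∈ K) (hu : u ∈ U) :
    |g k u| ≤ rectNorm K U g := by
  refine le_csSup ⟨B, ?_⟩ ⟨(k, u), ⟨hk, hu⟩, rfl⟩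
  rintro _ ⟨⟨a, b⟩, ⟨ha, hb⟩, rfl⟩
  exact hB a ha b hb

theorem abs_le_rectNorm_of_eq {K U : Set ℝ} {g : ℝ → ℝ → ℝ} {h : ℝ → ℝ} {k u : ℝ}
    (hU : IsCompact U) (hh : ContinuousOn h U) (hg : ∀ k ∈ K, ∀ u ∈ U, g k u = h u)
    (hk : k ∈ K) (hu : u ∈ U) : |g k u| ≤ rectNorm K U g := by
  obtain ⟨B, hB⟩ := hU.exists_bound_of_continuousOn hh
  exact abs_le_rectNorm (fun a ha b hb => hg a ha b hb ▸ hB b hb) hk hu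

theorem rectNorm_nonneg (K U : Set ℝ) (g : ℝ → ℝ → ℝ) : 0 ≤ rectNorm K U g := by
  refine Real.sSup_nonneg ?_
  rintro _ ⟨_, _, rfl⟩
  exact abs_nonneg _

namespace IsConvexFlux

variable {klo khi ulo uhi γ₁ γ₂ : ℝ} {f : ℝ → ℝ → ℝ} {k k' u : ℝ}

theorem lo_lt_hi (hf : IsConvexFlux klo khi ulo uhi γ₁ γ₂ f) (hk : klo ≤ khi) (hu : ulo ≤ uhi) :
    ulo < uhi := by
  refine hu.lt_of_ne fun heq => ?_
  subst heq
  have hlower := hf.lower klo (left_mem_Icc.2 hk) ulo (left_mem_Icc.2 le_rfl)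
  exact (hf.gamma_pos.trans_le hlower).ne' (derivWithin_Icc_self _ _ _)

theorem partialK_eq (hf : IsConvexFlux klo khi ulo uhi γ₁ γ₂ f) (hk : k ∈ Icc klo khi)
    (hu : u ∈ Icc ulo uhi) : partialK (Icc klo khi) f k u = partialK (Icc klo khi) f klo u := by
  rcases (hk.1.trans hk.2).eq_or_lt with h | h
  · rw [le_antisymm (hk.2.trans h.symm.le) hk.1]
  have hdiff : DifferentiableOn ℝ (fun c => partialK (Icc klo khi) f c u) (Icc klo khi) :=
    ((hf.contDiff_k u hu).derivWithin (m := 1) (uniqueDiffOn_Icc h)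
      (by norm_num)).differentiableOn one_ne_zero
  exact constant_of_derivWithin_zero hdiff
    (fun c hc => hf.kk_eq_zero u hu c (Ico_subset_Icc_self hc)) k hk

theorem sub_eq_partialK_mul (hf : IsConvexFlux klo khi ulo uhi γ₁ γ₂ f) (hk : k ∈ Icc klo khi)
    (hk' : k' ∈ Icc klo khi) (hu : u ∈ Icc ulo uhi) :
    f k' u - f k u = partialK (Icc klo khi) f klo u * (k' - k) := by
  obtain ⟨c, hc, h⟩ := exists_sub_eq_derivWithin_mul (convex_Icc klo khi)
    ((hf.contDiff_k u hu).differentiableOn two_ne_zero) hk hk'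
  rw [h, ← hf.partialK_eq (uIcc_subset_Icc hk hk' hc) hu, partialK]

theorem contDiffOn_partialK (hf : IsConvexFlux klo khi ulo uhi γ₁ γ₂ f) (hk : klo ≤ khi) :
    ContDiffOn ℝ 3 (partialK (Icc klo khi) f klo) (Icc ulo uhi) := by
  rcases hk.eq_or_lt with rfl | h
  · exact (contDiffOn_const (c := (0 : ℝ))).congr fun u _ => derivWithin_Icc_self _ _ _
  refine (((hf.contDiff_u khi (right_mem_Icc.2 hk)).sub
    (hf.contDiff_u klo (left_mem_Icc.2 hk))).div_const (khi - klo)).congr fun u hu => ?_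
  rw [eq_div_iff (sub_pos.2 h).ne',
    hf.sub_eq_partialK_mul (left_mem_Icc.2 hk) (right_mem_Icc.2 hk) hu]

theorem continuousOn_partialU_partialK (hf : IsConvexFlux klo khi ulo uhi γ₁ γ₂ f) (hk : klo ≤ khi)
    (hU : ulo < uhi) :
    ContinuousOn (partialU (Icc ulo uhi) (partialK (Icc klo khi) f) klo) (Icc ulo uhi) :=
  (hf.contDiffOn_partialK hk).continuousOn_derivWithin (uniqueDiffOn_Icc hU) (by norm_num)

theorem partialU_partialK_eq (hf : IsConvexFlux klo khi ulo uhi γ₁ γ₂ f) (hk : k ∈ Icc klo khi)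
    (hu : u ∈ Icc ulo uhi) :
    partialU (Icc ulo uhi) (partialK (Icc klo khi) f) k u
      = partialU (Icc ulo uhi) (partialK (Icc klo khi) f) klo u :=
  derivWithin_congr (fun _ hv => hf.partialK_eq hk hv) (hf.partialK_eq hk hu)

theorem partialU_sub_eq_mul (hf : IsConvexFlux klo khi ulo uhi γ₁ γ₂ f) (hU : ulo < uhi)
    (hk : k ∈ Icc klo khi) (hk' : k' ∈ Icc klo khi) (hu : u ∈ Icc ulo uhi) :
    partialU (Icc ulo uhi) f k' u - partialU (Icc ulo uhi) f k u
      = partialU (Icc ulo uhi) (partialK (Icc klo khi) f) klo u * (k' - k) := by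
  have hderiv : HasDerivWithinAt (f k)
      (partialU (Icc ulo uhi) f k u) (Icc ulo uhi) u :=
    ((hf.contDiff_u k hk).differentiableOn three_ne_zero u hu).hasDerivWithinAt
  have hslope := (((hf.contDiffOn_partialK (hk.1.trans hk.2)).differentiableOn three_ne_zero) u
    hu).hasDerivWithinAt.mul_const (k' - k)
  have heq : ∀ v ∈ Icc ulo uhi, f k' v = f k v + partialK (Icc klo khi) f klo v * (k' - k) :=
    fun v hv => by rw [← hf.sub_eq_partialK_mul hk hk' hv, add_sub_cancel]
  rw [sub_eq_iff_eq_add']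
  exact ((hderiv.add hslope).congr heq (heq u hu)).derivWithin (uniqueDiffOn_Icc hU u hu)

theorem differentiableOn_partialU (hf : IsConvexFlux klo khi ulo uhi γ₁ γ₂ f) (hU : ulo < uhi)
    (hk : k ∈ Icc klo khi) :
    DifferentiableOn ℝ (partialU (Icc ulo uhi) f k) (Icc ulo uhi) :=
  ((hf.contDiff_u k hk).derivWithin (m := 2) (uniqueDiffOn_Icc hU)
    (by norm_num)).differentiableOn two_ne_zero

theorem partialU_sub_mem_Icc (hf : IsConvexFlux klo khi ulo uhi γ₁ γ₂ f) (hU : ulo < uhi)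
    (hk : k ∈ Icc klo khi) {x y : ℝ} (hx : x ∈ Icc ulo uhi) (hy : y ∈ Icc ulo uhi) (hxy : x ≤ y) :
    partialU (Icc ulo uhi) f k y - partialU (Icc ulo uhi) f k x
      ∈ Icc (γ₁ * (y - x)) (γ₂ * (y - x)) := by
  obtain ⟨t, ht, h⟩ := exists_sub_eq_derivWithin_mul (convex_Icc ulo uhi)
    (hf.differentiableOn_partialU hU hk) hx hy
  have htU := uIcc_subset_Icc hx hy ht
  have hpos := sub_nonneg.2 hxy
  rw [h]
  exact ⟨mul_le_mul_of_nonneg_right (hf.lower k hk t htU) hpos,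
    mul_le_mul_of_nonneg_right (hf.upper k hk t htU) hpos⟩

theorem abs_partialU_le_rectNorm (hf : IsConvexFlux klo khi ulo uhi γ₁ γ₂ f) (hU : ulo < uhi)
    (hk : k ∈ Icc klo khi) (hu : u ∈ Icc ulo uhi) :
    |partialU (Icc ulo uhi) f k u|
      ≤ rectNorm (Icc klo khi) (Icc ulo uhi) (partialU (Icc ulo uhi) f) := by
  have hkk := hk.1.trans hk.2
  have hlo : klo ∈ Icc klo khi := left_mem_Icc.2 hkk
  obtain ⟨A, hA⟩ := isCompact_Icc.exists_bound_of_continuousOn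
    (hf.differentiableOn_partialU hU hlo).continuousOn
  obtain ⟨B, hB⟩ := isCompact_Icc.exists_bound_of_continuousOn
    (hf.continuousOn_partialU_partialK hkk hU)
  refine abs_le_rectNorm (B := A + B * (khi - klo)) (fun a ha b hb => ?_) hk hu
  have hab : |a - klo| ≤ khi - klo := by
    rw [abs_of_nonneg (sub_nonneg.2 ha.1)]; exact sub_le_sub_right ha.2 _
  rw [← add_sub_cancel (partialU _ f klo b) (partialU _ f a b),
    hf.partialU_sub_eq_mul hU hlo ha hb]
  refine (abs_add_le _ _).trans (add_le_add (hA b hb) ?_)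
  rw [abs_mul]
  exact mul_le_mul (hB b hb) hab (abs_nonneg _) ((abs_nonneg _).trans (hB b hb))

theorem isLipschitzConvexFlux (hf : IsConvexFlux klo khi ulo uhi γ₁ γ₂ f) (hk : klo ≤ khi)
    (hu : ulo ≤ uhi) :
    IsLipschitzConvexFlux (Icc klo khi) ulo uhi γ₁ γ₂
      (rectNorm (Icc klo khi) (Icc ulo uhi) (partialU (Icc ulo uhi) f))
      (rectNorm (Icc klo khi) (Icc ulo uhi) (partialK (Icc klo khi) f))
      (rectNorm (Icc klo khi) (Icc ulo uhi)
        (partialU (Icc ulo uhi) (partialK (Icc klo khi) f))) f := by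
  have hU := hf.lo_lt_hi hk hu
  have hlo := left_mem_Icc.2 hk
  exact {
    gamma₁_nonneg := hf.gamma_pos.le
    gamma₂_nonneg := hf.gamma_pos.le.trans
      ((hf.lower klo hlo ulo (left_mem_Icc.2 hu)).trans (hf.upper klo hlo ulo (left_mem_Icc.2 hu)))
    differentiableOn := fun k hk => (hf.contDiff_u k hk).differentiableOn three_ne_zero
    mul_le_partialU_sub := fun k hk x hx y hy hxy => (hf.partialU_sub_mem_Icc hU hk hx hy hxy).1
    partialU_sub_le_mul := fun k hk x hx y hy hxy => (hf.partialU_sub_mem_Icc hU hk hx hy hxy).2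
    abs_partialU_le := fun k hk u hu => hf.abs_partialU_le_rectNorm hU hk hu
    flux_lipschitz := fun k hk k' hk' u hu => by
      rw [hf.sub_eq_partialK_mul hk hk' hu, abs_mul]
      gcongr
      exact abs_le_rectNorm_of_eq isCompact_Icc (hf.contDiffOn_partialK ‹_›).continuousOn
        (fun _ hc _ hv => hf.partialK_eq hc hv) hlo hu
    speed_lipschitz := fun k hk k' hk' u hu => by
      rw [hf.partialU_sub_eq_mul hU hk hk' hu, abs_mul]
      gcongr
      exact abs_le_rectNorm_of_eq isCompact_Icc (hf.continuousOn_partialU_partialK ‹_› hU)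
        (fun _ hc _ hv => hf.partialU_partialK_eq hc hv) hlo hu }

end IsConvexFlux

/-! ### The one-sided estimate -/

theorem NormalizedStep.tsum_sq_rise_schemeStep_le {K : Set ℝ} {ulo uhi g Λ κ L M : ℝ}
    {f : ℝ → ℝ → ℝ} {kd u : ℤ → ℝ} (h : NormalizedStep K ulo uhi g Λ κ L M f kd u)
    (hkd : Summable fun j => |kd (j + 1) - kd j|) (hs : SqSummable (rise u))
    {B : ℝ} (hB : ∀ j, coeffJump L kd j ≤ B) :
    SqSummable (rise (schemeStep 1 (Icc ulo uhi) f kd u)) ∧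
    (Summable fun j => rise u j ^ 3) ∧
    ∑' j, rise (schemeStep 1 (Icc ulo uhi) f kd u) j ^ 2
      ≤ ∑' j, rise u j ^ 2 - 1 / 500 * g * ∑' j, rise u j ^ 3
        + (2 * (uhi - ulo) ^ 2 * M + (4 * (uhi - ulo) + 4 * B) * L)
          * ∑' j, |kd (j + 1) - kd j| := by
  have hshift (j : ℤ) : rise u j = upJump u (j + -1) := (upJump_sub_one u j).symm
  have hsq : SqSummable (upJump u) := (hs.shift 1).congr fun j => by
    simp only [hshift, add_neg_cancel_right]
  have htelescope := h.telescopeLE_sq_rise_schemeStep hkd hsq hB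
  have hcube := (h.convexStep hkd hsq).summable_cube
  have hdecay := hcube.mul_left (1 / 500 * g)
  have herror := hkd.mul_left (2 * (uhi - ulo) ^ 2 * M + (4 * (uhi - ulo) + 4 * B) * L)
  have hright := (Summable.sub hsq hdecay).add herror
  have hleft := htelescope.summable (fun j => sq_nonneg _) hright
  simp only [hshift]
  rw [tsum_int_shift (fun j => upJump u j ^ 2), tsum_int_shift (fun j => upJump u j ^ 3)]
  refine ⟨hleft, summable_int_shift hcube (-1), (htelescope.tsum_le hleft hright).trans_eq ?_⟩
  rw [(Summable.sub hsq hdecay).tsum_add herror, Summable.tsum_sub hsq hdecay, tsum_mul_left,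
    tsum_mul_left]

theorem schemeStep_eq_schemeStep_one (lam : ℝ) (U : Set ℝ) (f : ℝ → ℝ → ℝ) (kd u : ℤ → ℝ) :
    schemeStep lam U f kd u = schemeStep 1 U (fun k u => lam * f k u) kd u := by
  have hpartial (k u : ℝ) : partialU U (fun k u => lam * f k u) k u = lam * partialU U f k u :=
    derivWithin_const_mul_field lam
  have hmid (j : ℤ) : midValue lam U f kd u j = midValue 1 U (fun k u => lam * f k u) kd u j := by
    rw [midValue, midValue, hpartial]; ring
  ext j
  rw [schemeStep, schemeStep, hmid, hmid]
  ring

theorem mainTheorem6_general {K : Set ℝ} {ulo uhi γ₁ γ₂ A L M : ℝ} {f : ℝ → ℝ → ℝ}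
    (hf : IsLipschitzConvexFlux K ulo uhi γ₁ γ₂ A L M f) (hL : 0 ≤ L) (hM : 0 ≤ M)
    {k : ℝ → ℝ} (hk : MemLp k ∞ volume) (hvar : totalVar k ≠ ∞)
    (hK : Convex ℝ K) (hKc : IsClosed K) (hkK : ∀ᵐ x, k x ∈ K)
    {dx lam : ℝ} (hdx : 0 < dx) (hlam : 0 ≤ lam) (x₀ : ℝ)
    (hA : lam * A ≤ 1 / 4000) (hγ : lam * A * γ₂ ≤ γ₁ / 7500)
    {u : ℤ → ℝ} (hmem : ∀ j, u j ∈ Icc ulo uhi) (hs : SqSummable (rise u)) :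
    SqSummable (rise (schemeStep lam (Icc ulo uhi) f (cellAverage dx x₀ k) u)) ∧
    (Summable fun j => rise u j ^ 3) ∧
    ∑' j, rise (schemeStep lam (Icc ulo uhi) f (cellAverage dx x₀ k) u) j ^ 2
      ≤ ∑' j, rise u j ^ 2 - 1 / 500 * (lam * γ₁) * ∑' j, rise u j ^ 3
        + (2 * (uhi - ulo) ^ 2 * (lam * M)
            + (4 * (uhi - ulo) + 8 * (lam * L) * supNorm k) * (lam * L)) * bvNorm k := by
  have hkint := hk.locallyIntegrable le_top
  have hstep : NormalizedStep K ulo uhi (lam * γ₁) (lam * γ₂) (lam * A) (lam * L) (lam * M)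
      (fun k u => lam * f k u) (cellAverage dx x₀ k) u :=
    { flux := hf.const_mul hlam
      kd_mem := cellAverage_mem hkint hK hKc hkK hdx
      u_mem := hmem
      kappa_le := hA
      kappa_mul_le := by linarith [mul_le_mul_of_nonneg_left hγ hlam] }
  have hcoeff (j : ℤ) :
      coeffJump (lam * L) (cellAverage dx x₀ k) j ≤ lam * L * (2 * supNorm k) := by
    refine mul_le_mul_of_nonneg_left ?_ (mul_nonneg hlam hL)
    linarith [abs_sub (cellAverage dx x₀ k (j + 1)) (cellAverage dx x₀ k j),
      abs_cellAverage_le_supNorm (x₀ := x₀) hk hdx j,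
      abs_cellAverage_le_supNorm (x₀ := x₀) hk hdx (j + 1)]
  obtain ⟨hsq, hcube, hle⟩ := hstep.tsum_sq_rise_schemeStep_le
    (summable_abs_cellAverage_sub hkint hvar hdx) hs hcoeff
  rw [schemeStep_eq_schemeStep_one]
  refine ⟨hsq, hcube, hle.trans (add_le_add_right ?_ _)⟩
  have hW : 0 ≤ uhi - ulo := sub_nonneg.2 ((hmem 0).1.trans (hmem 0).2)
  have hsup : 0 ≤ supNorm k := ENNReal.toReal_nonneg
  rw [show 4 * (lam * L * (2 * supNorm k)) = 8 * (lam * L) * supNorm k by ring]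
  exact mul_le_mul_of_nonneg_left (tsum_abs_cellAverage_sub_le_bvNorm hkint hvar hdx)
    (by positivity)

theorem le_oslConst {W lam C γ₂ nfu nfk nfuk nfku nk : ℝ} (hW : 0 ≤ W) (hWC : W ≤ 2 * C)
    (hlam : 0 ≤ lam) (hγ₂ : 0 ≤ γ₂) (hfu : 0 ≤ nfu) (hfk : 0 ≤ nfk) (hfuk : 0 ≤ nfuk)
    (hfku : 0 ≤ nfku) (hk : 0 ≤ nk) :
    2 * W ^ 2 * (lam * nfku) + (4 * W + 8 * (lam * nfk) * nk) * (lam * nfk)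
      ≤ oslConst lam C γ₂ nfu nfk nfuk nfku nk := by
  have hC : 0 ≤ C := by linarith
  calc _ ≤ 2 * (2 * C) ^ 2 * (lam * nfku) + (4 * (2 * C) + 8 * (lam * nfk) * nk) * (lam * nfk) := by
        gcongr
    _ ≤ _ := by
      rw [oslConst, ← sub_nonneg]
      ring_nf
      positivity

theorem sub_le_two_mul_max_abs (a b : ℝ) : b - a ≤ 2 * max |a| |b| := by
  linarith [neg_abs_le a, le_abs_self b, le_max_left |a| |b|, le_max_right |a| |b|]

theorem mainTheorem6
    (klo khi ulo uhi γ₁ γ₂ : ℝ) (hk : klo ≤ khi) (hu : ulo ≤ uhi)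
    (f : ℝ → ℝ → ℝ) (hf : IsConvexFlux klo khi ulo uhi γ₁ γ₂ f)
    (k : ℝ → ℝ) (hkBV : IsCoefficient klo khi k)
    (dx dt lam : ℝ) (hdx : 0 < dx) (hdt : 0 < dt) (hlam : lam = dt / dx) (x₀ : ℝ)
    (nfu nfk nfuk nfku C : ℝ)
    (hnfu : nfu = rectNorm (Icc klo khi) (Icc ulo uhi) (partialU (Icc ulo uhi) f))
    (hnfk : nfk = rectNorm (Icc klo khi) (Icc ulo uhi) (partialK (Icc klo khi) f))
    (hnfuk : nfuk = rectNorm (Icc klo khi) (Icc ulo uhi)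
      (partialK (Icc klo khi) (partialU (Icc ulo uhi) f)))
    (hnfku : nfku = rectNorm (Icc klo khi) (Icc ulo uhi)
      (partialU (Icc ulo uhi) (partialK (Icc klo khi) f)))
    (hC : C = max |ulo| |uhi|)
    (κ : ℝ) (hκ : lam * nfu ≤ κ) (hCFL : κ ≤ min (γ₁ / (7500 * γ₂)) (1 / 4000))
    (u u' : ℤ → ℝ) (hmem : ∀ j, u j ∈ Icc ulo uhi)
    (hstep : ∀ j, u' j = schemeStep lam (Icc ulo uhi) f (cellAverage dx x₀ k) u j) :
    (Summable fun j : ℤ => (max (u j - u (j - 1)) 0) ^ 2) →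
    (Summable fun j : ℤ => (max (u' j - u' (j - 1)) 0) ^ 2) ∧
    (Summable fun j : ℤ => (max (u j - u (j - 1)) 0) ^ 3) ∧
    ∑' j : ℤ, (max (u' j - u' (j - 1)) 0) ^ 2 ≤
      ∑' j : ℤ, (max (u j - u (j - 1)) 0) ^ 2
        - 1 / 500 * lam * γ₁ * ∑' j : ℤ, (max (u j - u (j - 1)) 0) ^ 3
        + oslConst lam C γ₂ nfu nfk nfuk nfku (supNorm k) * bvNorm k := by
  intro hs
  have hlam₀ : 0 ≤ lam := by rw [hlam]; positivity
  have hflux := hf.isLipschitzConvexFlux hk hu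
  rw [← hnfu, ← hnfk, ← hnfku] at hflux
  have hfu : 0 ≤ nfu := hnfu ▸ rectNorm_nonneg _ _ _
  have hfk : 0 ≤ nfk := hnfk ▸ rectNorm_nonneg _ _ _
  have hfuk : 0 ≤ nfuk := hnfuk ▸ rectNorm_nonneg _ _ _
  have hfku : 0 ≤ nfku := hnfku ▸ rectNorm_nonneg _ _ _
  have hγ : lam * nfu * γ₂ ≤ γ₁ / 7500 :=
    mul_le_of_le_div₀ (div_nonneg hflux.gamma₁_nonneg (by norm_num)) hflux.gamma₂_nonneg <|
      (hκ.trans (hCFL.trans (min_le_left _ _))).trans_eq (div_div _ _ _).symm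
  obtain ⟨hsq, hcube, hle⟩ := mainTheorem6_general hflux hfk hfku hkBV.memLp hkBV.finite_var
    (convex_Icc klo khi) isClosed_Icc hkBV.mem_Icc hdx hlam₀ x₀
    (hκ.trans (hCFL.trans (min_le_right _ _))) hγ hmem hs
  rw [← mul_assoc, ← funext hstep] at hle
  rw [← funext hstep] at hsq
  have hconst := le_oslConst (sub_nonneg.2 hu) (hC ▸ sub_le_two_mul_max_abs ulo uhi) hlam₀
    hflux.gamma₂_nonneg hfu hfk hfuk hfku (ENNReal.toReal_nonneg (a := eLpNorm k ∞ volume))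
  exact ⟨hsq, hcube, hle.trans (add_le_add_right
    (mul_le_mul_of_nonneg_right hconst ENNReal.toReal_nonneg) _)⟩
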